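/- Corollary 6 ($L^1$ convergence of $\hat f_{n,\ell}$). Let $f$ be a probability density on $\mathbb{R}^2$ that is continuous at almost every point, and let $(X_1,Y_1),(X_2,Y_2),\dots$ be i.i.d. random points with density $f$. Let $\ell=\ell(n)$ be positive integers (for large $n$) with $\ell(n)\to\infty$ and $\ell(n)^2=o(n)$. For each $n$ divide the range $[\min_{v\le n}X_v,\max_{v\le n}X_v]$ into $\ell$ segments of equal width $w_n^X=(\max_{v\le n} X_v-\min_{v\le n} X_v)/\ell(n)$ and likewise the range of $Y_1,\dots,Y_n$ into $\ell$ segments of equal width $w_n^Y$, which gives $\ell^2$ rectangular cells $P_k$, and assume that the cells shrink: $w_n^X\to0$ and $w_n^Y\to0$ almost surely. Let $n_k$ be the number of the first $n$ sample points in $P_k$, let $m_k=\lfloor\sqrt{n_k}+1/2\rfloor$, and let $x^k_{(1)}\le\dots\le x^k_{(n_k)}$ and $y^k_{(1)}\le\dots\le y^k_{(n_k)}$ be the ordered coordinates of the sample points in $P_k$, with $x^k_{(i)}=x^k_{(1)}$ for $i<1$ and $x^k_{(i)}=x^k_{(n_k)}$ for $i>n_k$, and similarly for $y$. Put $\xi^k_0=x^k_{(1)}$,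 $\xi^k_{n_k+1}=x^k_{(n_k)}$ and $$\xi^k_i=\frac{x^k_{(i-m_k)}+\dots+x^k_{(i+m_k-1)}}{2m_k}\qquad(1\le i\le n_k),$$ and define $\eta^k_j$ analogously from the $y^k_{(j)}$. The partitioned sample-spacing density estimator is $$\hat f_{n,\ell}(x,y)=\frac{n_k}{n}\cdot\frac{4m_k^2}{n_k^2\,\bigl(x^k_{(i+m_k)}-x^k_{(i-m_k)}\bigr)\bigl(y^k_{(j+m_k)}-y^k_{(j-m_k)}\bigr)}$$ for $(x,y)\in(\xi^k_i,\xi^k_{i+1}]\times(\eta^k_j,\eta^k_{j+1}]$, $0\le i,j\le n_k$, where $k$ runs over the cells with $n_k\ge2$, and $\hat f_{n,\ell}(x,y)=0$ at all other points. Then, almost surely, $\hat f_{n,\ell}$ is integrable for every $n$ and $$\int_{\mathbb{R}^2}\bigl|\hat f_{n,\ell}(x,y)-f(x,y)\bigr|\,dx\,dy\;\longrightarrow\;0\qquad(n\to\infty).$$ -/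

import Mathlib

open Filter Topology MeasureTheory ProbabilityTheory Asymptotics

noncomputable section

/-- The `i`-th order statistic `s_(i)` (indices start at `1`) of a finite sample of reals `s`,
with the convention `s_(i) = s_(1)` for `i < 1` and `s_(i) = s_(n)` for `i > n`, where `n` is the
sample size (and the value `0` for the empty sample). -/
def orderStat (s : Multiset ℝ) (i : ℤ) : ℝ :=
  (s.sort (· ≤ ·)).getD (min (i - 1).toNat (s.card - 1)) 0

/-- The spacing parameter `⌊√N + 1/2⌋` of a (sub)sample of size `N`. -/
def spacingParam (N : ℕ) : ℕ := ⌊Real.sqrt N + 1 / 2⌋₊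

/-- The grid points `ξ_0, …, ξ_{N+1}` of a sample `s` of size `N`:
`ξ_0 = s_(1)`, `ξ_{N+1} = s_(N)`, and
`ξ_i = (s_(i-m) + ⋯ + s_(i+m-1)) / (2m)` for `1 ≤ i ≤ N`, where `m = ⌊√N + 1/2⌋`. -/
def gridPoint (s : Multiset ℝ) (i : ℕ) : ℝ :=
  if i = 0 then orderStat s 1
  else if i = s.card + 1 then orderStat s s.card
  else (∑ r ∈ Finset.Ico ((i : ℤ) - spacingParam s.card) ((i : ℤ) + spacingParam s.card),
    orderStat s r) / (2 * spacingParam s.card)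

/-- The univariate sample-spacing density estimator of a sample `s` of size `N`: the value is
`2m / (N (s_(i+m) - s_(i-m)))` on `(ξ_i, ξ_{i+1}]` for `i = 0, …, N`, and `0` elsewhere.
For `N = 0` and `N = 1` all these intervals are empty. -/
def spacingDensity (s : Multiset ℝ) (x : ℝ) : ℝ :=
  ∑ i ∈ Finset.range (s.card + 1),
    (Set.Ioc (gridPoint s i) (gridPoint s (i + 1))).indicator
      (fun _ => 2 * (spacingParam s.card : ℝ) /
        (s.card * (orderStat s ((i : ℤ) + spacingParam s.card) -
          orderStat s ((i : ℤ) - spacingParam s.card)))) x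

/-- The common width `(max s - min s) / ℓ` of the `ℓ` segments of the range of the sample `s`. -/
def segmentWidth (s : Multiset ℝ) (ℓ : ℕ) : ℝ :=
  (orderStat s s.card - orderStat s 1) / ℓ

/-- The `a`-th (`a = 0, …, ℓ - 1`) of the `ℓ` equal-width segments into which the range
`[min s, max s]` of the sample `s` is divided; they are half-open, except that the last one
contains the right end point. -/
def rangeSegment (s : Multiset ℝ) (ℓ a : ℕ) : Set ℝ :=
  if a + 1 = ℓ then Set.Icc (orderStat s 1 + a * segmentWidth s ℓ) (orderStat s s.card)
  else Set.Ico (orderStat s 1 + a * segmentWidth s ℓ) (orderStat s 1 + (a + 1) * segmentWidth s ℓ)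

open Classical in
/-- The subsample of the points of `S` in the cell `(a, b)` of the `ℓ × ℓ` partition of the
rectangle spanned by the ranges of the two coordinates of `S`. -/
def cellSample (S : Multiset (ℝ × ℝ)) (ℓ a b : ℕ) : Multiset (ℝ × ℝ) :=
  S.filter fun p => p.1 ∈ rangeSegment (S.map Prod.fst) ℓ a ∧ p.2 ∈ rangeSegment (S.map Prod.snd) ℓ b

/-- The partitioned sample-spacing density estimator built from the bivariate sample `S` with
`ℓ ^ 2` cells. On the part of the grid of the cell `(a, b)` it is
`n_k / n` times the product of the two univariate estimators of the coordinates of the points in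
that cell. These univariate estimators vanish off the ranges of their samples, and the cells are
disjoint products of intervals, so at most one summand is nonzero at any point. -/
def partitionedDensity (S : Multiset (ℝ × ℝ)) (ℓ : ℕ) (p : ℝ × ℝ) : ℝ :=
  ∑ a ∈ Finset.range ℓ, ∑ b ∈ Finset.range ℓ,
    ((cellSample S ℓ a b).card : ℝ) / S.card *
      (spacingDensity ((cellSample S ℓ a b).map Prod.fst) p.1 *
        spacingDensity ((cellSample S ℓ a b).map Prod.snd) p.2)

/-- The sample formed by the first `n` members of a sequence of random points of the plane. -/
def firstSample {Ω : Type*} (Z : ℕ → Ω → ℝ × ℝ) (n : ℕ) (ω : Ω) : Multiset (ℝ × ℝ) :=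
  (Multiset.range n).map fun i => Z i ω

end

/-! Since `|g - f| = g + f - 2 * min f g`, it suffices that the estimator has mass at most `1 +
o(1)` and that its overlap `∫ min f g` with the density has lower limit at least `1`. The mass bound
is deterministic (`integral_partitionedDensity_le`): every interior grid step carries mass at most
`1 / N`, only the two outer steps of a cell exceed this, and the total excess is controlled by `ℓ ^
2 = o(n)`.

For the overlap (`le_integral_min`), truncate `f` to a bounded function on a box and replace it by
its infimum `c i` on each cell. As the cells shrink, almost everywhere continuity and dominated
convergence make the mass of these step functions converge to that of the truncation, which is close
to `1`. In a cell of sides `w`, `v`, area `A = w * v`, holding `N` of the `n` points, the overlap is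
at least `min (c * A) (N / n)` times the overlaps of the two univariate estimators with the uniform
densities on the sides (`mul_le_setIntegral_min`). Three errors must be small in total: cells
holding too few points, and the missing univariate mass in each of the two directions.

The missing univariate mass is turned into a statement about counts (`exists_sparse_intervals`). The
grid steps are spacings over windows of `2 * m` ranks, and a window loses mass only if it is too
long for its number of points. Averaging over residue classes of ranks modulo `2 * m` gives disjoint
windows, at most `√N` of them, whose shortage of points accounts for the loss up to `4 * m`.

So everything reduces to one inequality: the empirical measure does not fall short of the true one,
by more than `ε`, on the union over all cells of these thin strips. The strips depend on the sample,
so they are approximated from inside by dyadic rectangles. Hoeffding's inequality and a union bound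
handle all unions of rectangles of a dyadic mesh at once, provided that the mesh has at most a small
multiple of `n` rectangles (`ae_eventually_dyadic_deficit_lt`). With `√N` strips per cell, the mesh
must be finer than the cell side by a factor of order `√(n * A)`; Cauchy–Schwarz then bounds the
boundary loss (`sum_mul_sqrt_le`). Such a mesh has of order `n / √(n * A)` rectangles, which is
`o(n)` because `n * A → ∞` by `ℓ ^ 2 = o(n)` (`eventually_le_mul_area`). -/

/-! ### Order statistics and the spacing grid. -/

theorem orderStat_mono (s : Multiset ℝ) {i j : ℤ} (hij : i ≤ j) : orderStat s i ≤ orderStat s j := by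
  unfold orderStat
  set L := s.sort (· ≤ ·) with hL
  have hlen : L.length = s.card := Multiset.length_sort _
  have hp : L.Pairwise (· ≤ ·) := Multiset.pairwise_sort _ _
  rcases Nat.eq_zero_or_pos s.card with h0 | h0
  · have : L = [] := List.length_eq_zero_iff.1 (by omega)
    simp [this]
  have h1 : min (i - 1).toNat (s.card - 1) < L.length := by omega
  have h2 : min (j - 1).toNat (s.card - 1) < L.length := by omega
  have h3 : min (i - 1).toNat (s.card - 1) ≤ min (j - 1).toNat (s.card - 1) := by omega
  rw [List.getD_eq_getElem _ _ h1, List.getD_eq_getElem _ _ h2]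
  rcases h3.eq_or_lt with h | h
  · exact le_of_eq (getElem_congr_idx h)
  · exact List.pairwise_iff_getElem.1 hp _ _ h1 h2 h

theorem orderStat_mem {s : Multiset ℝ} (hs : 0 < s.card) (i : ℤ) : orderStat s i ∈ s := by
  unfold orderStat
  have hlen : (s.sort (· ≤ ·)).length = s.card := Multiset.length_sort _
  rw [List.getD_eq_getElem _ _ (by omega), ← Multiset.mem_sort (r := (· ≤ ·))]
  exact List.getElem_mem _

theorem orderStat_of_le_one (s : Multiset ℝ) {i : ℤ} (hi : i ≤ 1) :
    orderStat s i = orderStat s 1 := by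
  unfold orderStat
  congr 1
  omega

theorem orderStat_of_card_le (s : Multiset ℝ) {i : ℤ} (hi : (s.card : ℤ) ≤ i) :
    orderStat s i = orderStat s s.card := by
  unfold orderStat
  congr 1
  omega

theorem map_range_orderStat (s : Multiset ℝ) :
    (Multiset.range s.card).map (fun k : ℕ => orderStat s ((k : ℤ) + 1)) = s := by
  have hlen : (s.sort (· ≤ ·)).length = s.card := Multiset.length_sort _
  conv_rhs => rw [← Multiset.sort_eq s (· ≤ ·)]
  rw [← Multiset.coe_range, Multiset.map_coe, Multiset.coe_eq_coe]
  refine List.Perm.of_eq (List.ext_getElem (by simp) fun k h1 h2 => ?_)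
  have hk : k < s.card := by omega
  simp only [List.getElem_map, List.getElem_range, orderStat]
  rw [← List.getD_eq_getElem _ 0 h2]
  congr 1
  omega

theorem orderStat_one_le {s : Multiset ℝ} {x : ℝ} (hx : x ∈ s) : orderStat s 1 ≤ x := by
  rw [← map_range_orderStat s, Multiset.mem_map] at hx
  obtain ⟨k, -, rfl⟩ := hx
  exact orderStat_mono s (by omega)

theorem le_orderStat_card {s : Multiset ℝ} {x : ℝ} (hx : x ∈ s) : x ≤ orderStat s s.card := by
  rw [← map_range_orderStat s, Multiset.mem_map] at hx
  obtain ⟨k, hk, rfl⟩ := hx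
  have := Multiset.mem_range.1 hk
  exact orderStat_mono s (by omega)

theorem spacingParam_pos {N : ℕ} (hN : 0 < N) : 0 < spacingParam N := by
  unfold spacingParam
  have : (1 : ℝ) ≤ Real.sqrt N := by
    rw [Real.one_le_sqrt]; exact_mod_cast hN
  exact Nat.floor_pos.2 (by linarith)

theorem spacingParam_le (N : ℕ) : (spacingParam N : ℝ) ≤ Real.sqrt N + 1 / 2 :=
  Nat.floor_le (by positivity)

/-- Used to bound by `√N` the number `N / (2 * m)` of disjoint windows of `2 * m` ranks. -/
theorem sqrt_le_two_mul_spacingParam {N : ℕ} (hN : 0 < N) : Real.sqrt N ≤ 2 * spacingParam N := by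
  have h1 : Real.sqrt N + 1 / 2 < spacingParam N + 1 := Nat.lt_floor_add_one _
  have h2 : (1 : ℝ) ≤ spacingParam N := by exact_mod_cast spacingParam_pos hN
  linarith

theorem gridPoint_of_mem {s : Multiset ℝ} {i : ℕ} (h1 : 1 ≤ i) (h2 : i ≤ s.card) :
    gridPoint s i = (∑ r ∈ Finset.Ico ((i : ℤ) - spacingParam s.card) ((i : ℤ) + spacingParam s.card),
      orderStat s r) / (2 * spacingParam s.card) := by
  rw [gridPoint, if_neg (by omega), if_neg (by omega)]

theorem gridPoint_mem_Icc {s : Multiset ℝ} {i : ℕ} (h1 : 1 ≤ i) (h2 : i ≤ s.card) :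
    gridPoint s i ∈ Set.Icc (orderStat s ((i : ℤ) - spacingParam s.card))
      (orderStat s ((i : ℤ) + spacingParam s.card)) := by
  have hm : (0 : ℝ) < spacingParam s.card := by exact_mod_cast spacingParam_pos (by omega)
  have hc : (Finset.Ico ((i : ℤ) - spacingParam s.card) ((i : ℤ) + spacingParam s.card)).card
      = 2 * spacingParam s.card := by
    rw [Int.card_Ico]; omega
  rw [gridPoint_of_mem h1 h2, Set.mem_Icc, le_div_iff₀ (by positivity), div_le_iff₀ (by positivity)]
  constructor
  · have := Finset.card_nsmul_le_sum (Finset.Ico ((i : ℤ) - spacingParam s.card)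
      ((i : ℤ) + spacingParam s.card)) (fun r => orderStat s r)
      (orderStat s ((i : ℤ) - spacingParam s.card))
      fun r hr => orderStat_mono s (Finset.mem_Ico.1 hr).1
    rw [hc, nsmul_eq_mul] at this
    push_cast at this
    linarith
  · have := Finset.sum_le_card_nsmul (Finset.Ico ((i : ℤ) - spacingParam s.card)
      ((i : ℤ) + spacingParam s.card)) (fun r => orderStat s r)
      (orderStat s ((i : ℤ) + spacingParam s.card))
      fun r hr => orderStat_mono s (Finset.mem_Ico.1 hr).2.le
    rw [hc, nsmul_eq_mul] at this
    push_cast at this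
    linarith

/-- Two neighbouring moving averages share all but their extreme terms. The length of an interior
step is thus inversely proportional to the height on it, so that a nondegenerate interior step has
area exactly `1 / N`. -/
theorem gridPoint_succ_sub {s : Multiset ℝ} {i : ℕ} (h1 : 1 ≤ i) (h2 : i < s.card) :
    gridPoint s (i + 1) - gridPoint s i =
      (orderStat s ((i : ℤ) + spacingParam s.card) - orderStat s ((i : ℤ) - spacingParam s.card)) /
        (2 * spacingParam s.card) := by
  rw [gridPoint_of_mem h1 h2.le, gridPoint_of_mem (by omega) (by omega), ← sub_div]
  congr 1
  have hm := spacingParam_pos (N := s.card) (by omega)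
  set m := spacingParam s.card
  have e1 : Finset.Ico ((i : ℤ) - m) (i + m) =
      insert ((i : ℤ) - m) (Finset.Ico ((i : ℤ) + 1 - m) (i + m)) := by
    ext; simp; omega
  have e2 : Finset.Ico (((i + 1 : ℕ) : ℤ) - m) ((i + 1 : ℕ) + m) =
      insert ((i : ℤ) + m) (Finset.Ico ((i : ℤ) + 1 - m) (i + m)) := by
    ext; simp; omega
  rw [e1, e2, Finset.sum_insert (by simp), Finset.sum_insert (by simp)]
  ring

/-- A crude bound, needed at `i = 0` and `i = N`, where one end of the step is an extreme order
statistic instead of an average and the telescoping fails. -/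
theorem gridPoint_succ_sub_le {s : Multiset ℝ} (hs : 0 < s.card) {i : ℕ} (h2 : i ≤ s.card) :
    gridPoint s (i + 1) - gridPoint s i ≤
      orderStat s ((i : ℤ) + spacingParam s.card) - orderStat s ((i : ℤ) - spacingParam s.card) := by
  have hm := spacingParam_pos hs
  rcases Nat.eq_zero_or_pos i with rfl | hi
  · have h0 : gridPoint s 0 = orderStat s 1 := by simp [gridPoint]
    have h3 := orderStat_of_le_one s (i := ((0 : ℕ) : ℤ) - spacingParam s.card) (by omega)
    have h4 := orderStat_mono s (i := 1) (j := ((0 : ℕ) : ℤ) + spacingParam s.card) (by omega)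
    rw [h0, h3]
    have h5 : gridPoint s (0 + 1) ≤ orderStat s (((0 : ℕ) : ℤ) + spacingParam s.card) := by
      rw [gridPoint_of_mem (by omega) (by omega), div_le_iff₀ (by positivity)]
      have := Finset.sum_le_card_nsmul (Finset.Ico (((0 + 1 : ℕ) : ℤ) - spacingParam s.card)
        (((0 + 1 : ℕ) : ℤ) + spacingParam s.card)) (fun r => orderStat s r)
        (orderStat s (((0 : ℕ) : ℤ) + spacingParam s.card))
        fun r hr => orderStat_mono s (by have := Finset.mem_Ico.1 hr; push_cast at this ⊢; omega)
      have hc : (Finset.Ico (((0 + 1 : ℕ) : ℤ) - spacingParam s.card)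
        (((0 + 1 : ℕ) : ℤ) + spacingParam s.card)).card = 2 * spacingParam s.card := by
        rw [Int.card_Ico]; omega
      rw [hc, nsmul_eq_mul] at this
      push_cast at this ⊢
      linarith
    linarith
  rcases h2.eq_or_lt with h | h
  · have h0 : gridPoint s (i + 1) = orderStat s s.card := by simp [gridPoint, h]
    have h3 := orderStat_of_card_le s (i := (i : ℤ) + spacingParam s.card) (by omega)
    rw [h0, h3]
    linarith [(gridPoint_mem_Icc hi h2).1]
  · rw [gridPoint_succ_sub hi h]
    have h4 := orderStat_mono s (i := (i : ℤ) - spacingParam s.card)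
      (j := (i : ℤ) + spacingParam s.card) (by omega)
    have : (1 : ℝ) ≤ spacingParam s.card := by exact_mod_cast hm
    exact div_le_self (by linarith) (by linarith)

/-! ### Mass of the univariate estimator and its overlap with a uniform density. -/

/-- The height of the spacing density on its `i`-th interval. -/
noncomputable def spacingHeight (s : Multiset ℝ) (i : ℕ) : ℝ :=
  2 * (spacingParam s.card : ℝ) / (s.card * (orderStat s ((i : ℤ) + spacingParam s.card) -
    orderStat s ((i : ℤ) - spacingParam s.card)))

theorem spacingHeight_nonneg (s : Multiset ℝ) (i : ℕ) : 0 ≤ spacingHeight s i := by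
  have := orderStat_mono s (i := (i : ℤ) - spacingParam s.card)
      (j := (i : ℤ) + spacingParam s.card) (by omega)
  unfold spacingHeight
  have : 0 ≤ orderStat s ((i : ℤ) + spacingParam s.card) -
    orderStat s ((i : ℤ) - spacingParam s.card) := by linarith
  positivity

theorem spacingDensity_eq (s : Multiset ℝ) : spacingDensity s = fun x =>
    ∑ i ∈ Finset.range (s.card + 1),
      (Set.Ioc (gridPoint s i) (gridPoint s (i + 1))).indicator (fun _ => spacingHeight s i) x := rfl

theorem spacingDensity_nonneg (s : Multiset ℝ) (x : ℝ) : 0 ≤ spacingDensity s x :=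
  Finset.sum_nonneg fun i _ => Set.indicator_nonneg (fun _ _ => spacingHeight_nonneg s i) x

theorem integrable_indicator_Ioc_const (a b c : ℝ) :
    Integrable ((Set.Ioc a b).indicator (fun _ => c)) :=
  (integrable_indicator_iff measurableSet_Ioc).2 (integrableOn_const (by simp))

theorem integrable_spacingDensity (s : Multiset ℝ) : Integrable (spacingDensity s) := by
  rw [spacingDensity_eq]
  exact integrable_finsetSum _ fun i _ => integrable_indicator_Ioc_const _ _ _

theorem measurable_spacingDensity (s : Multiset ℝ) : Measurable (spacingDensity s) := by
  rw [spacingDensity_eq]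
  exact Finset.measurable_fun_sum _ fun i _ => measurable_const.indicator measurableSet_Ioc

theorem integral_indicator_Ioc_const {a b : ℝ} (c : ℝ) :
    ∫ x, (Set.Ioc a b).indicator (fun _ => c) x = max (b - a) 0 * c := by
  rw [integral_indicator_const _ measurableSet_Ioc]
  simp [Measure.real, Real.volume_Ioc, ENNReal.toReal_ofReal', smul_eq_mul]

theorem sub_mul_spacingHeight_le {s : Multiset ℝ} (hs : 0 < s.card) {i : ℕ} (h2 : i ≤ s.card) :
    max (gridPoint s (i + 1) - gridPoint s i) 0 * spacingHeight s i ≤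
      2 * spacingParam s.card / s.card := by
  have h1 := gridPoint_succ_sub_le hs h2
  have hN : (0 : ℝ) < s.card := by exact_mod_cast hs
  have h3 := orderStat_mono s (i := (i : ℤ) - spacingParam s.card)
      (j := (i : ℤ) + spacingParam s.card) (by omega)
  unfold spacingHeight
  set D := orderStat s ((i : ℤ) + spacingParam s.card) - orderStat s ((i : ℤ) - spacingParam s.card)
    with hD
  have hD0 : 0 ≤ D := by linarith
  -- For coinciding order statistics the height is `0`, the default value of division by zero.
  rcases hD0.eq_or_lt with h | h
  · rw [← h]; simp; positivity
  · calc _ ≤ D * (2 * (spacingParam s.card : ℝ) / (s.card * D)) := by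
          gcongr; exact max_le h1 hD0
      _ = _ := by field_simp

theorem sub_mul_spacingHeight_le_inv {s : Multiset ℝ} {i : ℕ} (h1 : 1 ≤ i)
    (h2 : i < s.card) :
    max (gridPoint s (i + 1) - gridPoint s i) 0 * spacingHeight s i ≤ 1 / s.card := by
  have hN : (0 : ℝ) < s.card := by exact_mod_cast (by omega : 0 < s.card)
  have hm : (0 : ℝ) < spacingParam s.card := by exact_mod_cast spacingParam_pos (by omega)
  have h3 := orderStat_mono s (i := (i : ℤ) - spacingParam s.card)
      (j := (i : ℤ) + spacingParam s.card) (by omega)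
  rw [gridPoint_succ_sub h1 h2]
  unfold spacingHeight
  set D := orderStat s ((i : ℤ) + spacingParam s.card) - orderStat s ((i : ℤ) - spacingParam s.card)
    with hD
  have hD0 : 0 ≤ D := by linarith
  rcases hD0.eq_or_lt with h | h
  · rw [← h]; simp
  · rw [max_eq_left (by positivity)]
    apply le_of_eq
    field_simp

/-- The `N - 1` interior steps contribute at most `1 / N` each, and the two outer steps at most `2 *
m / N` each. -/
theorem integral_spacingDensity_le {s : Multiset ℝ} (hs : 0 < s.card) :
    ∫ x, spacingDensity s x ≤ 1 + 4 * spacingParam s.card / s.card := by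
  have hN : (0 : ℝ) < s.card := by exact_mod_cast hs
  rw [spacingDensity_eq, integral_finsetSum _ fun i _ => integrable_indicator_Ioc_const _ _ _]
  simp only [integral_indicator_Ioc_const]
  rw [Finset.sum_range_succ, Finset.sum_range_eq_add_Ico _ hs]
  have h0 := sub_mul_spacingHeight_le hs (i := 0) (by omega)
  have h1 := sub_mul_spacingHeight_le hs (i := s.card) le_rfl
  have h2 : ∑ i ∈ Finset.Ico 1 s.card,
      max (gridPoint s (i + 1) - gridPoint s i) 0 * spacingHeight s i ≤ 1 := by
    calc _ ≤ ∑ i ∈ Finset.Ico 1 s.card, 1 / (s.card : ℝ) :=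
          Finset.sum_le_sum fun i hi => sub_mul_spacingHeight_le_inv (Finset.mem_Ico.1 hi).1
            (Finset.mem_Ico.1 hi).2
      _ ≤ 1 := by
          rw [Finset.sum_const, Nat.card_Ico, nsmul_eq_mul, mul_one_div, div_le_one hN]
          exact_mod_cast Nat.sub_le _ _
  have e : 1 + 4 * (spacingParam s.card : ℝ) / s.card =
    2 * spacingParam s.card / s.card + 1 + 2 * spacingParam s.card / s.card := by ring
  linarith

/-- The interior steps do not overlap and lie in `[a, b]`. On a step of length `Δ` the truncated
density is at least the truncated height, and `Δ` times the height is `1 / N`. The outer steps are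
discarded. -/
theorem sum_Ico_min_le_integral {s : Multiset ℝ} {a b : ℝ} (hs : 0 < s.card)
    (hmem : ∀ x ∈ s, x ∈ Set.Icc a b) (hab : a < b) :
    ∑ i ∈ Finset.Ico 1 s.card, min ((gridPoint s (i + 1) - gridPoint s i) / (b - a)) (1 / s.card) ≤
      ∫ x in Set.Ioo a b, min (1 / (b - a)) (spacingDensity s x) := by
  have hw : 0 < b - a := by linarith
  have hN : (0 : ℝ) < s.card := by exact_mod_cast hs
  have hm : (0 : ℝ) < spacingParam s.card := by exact_mod_cast spacingParam_pos hs
  have hstep : ∀ i ∈ Finset.Ico 1 s.card, gridPoint s i ≤ gridPoint s (i + 1) := fun i hi => by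
    have h := gridPoint_succ_sub (Finset.mem_Ico.1 hi).1 (Finset.mem_Ico.1 hi).2
    have h3 := orderStat_mono s (i := (i : ℤ) - spacingParam s.card)
      (j := (i : ℤ) + spacingParam s.card) (by omega)
    have : 0 ≤ gridPoint s (i + 1) - gridPoint s i := by
      rw [h]; exact div_nonneg (by linarith) (by positivity)
    linarith
  have hmono : ∀ i j, 1 ≤ i → i ≤ j → j ≤ s.card → gridPoint s i ≤ gridPoint s j := by
    intro i j hi hij
    induction j, hij using Nat.le_induction with
    | base => exact fun _ => le_rfl
    | succ k hk ih =>
      exact fun hk2 => (ih (by omega)).trans (hstep k (Finset.mem_Ico.2 ⟨by omega, by omega⟩))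
  have hin : ∀ i, 1 ≤ i → i ≤ s.card → gridPoint s i ∈ Set.Icc a b := fun i h1 h2 =>
    ⟨(hmem _ (orderStat_mem hs _)).1.trans (gridPoint_mem_Icc h1 h2).1,
      (gridPoint_mem_Icc h1 h2).2.trans (hmem _ (orderStat_mem hs _)).2⟩
  have key : ∀ x, ∑ i ∈ Finset.Ico 1 s.card, (Set.Ioc (gridPoint s i) (gridPoint s (i + 1))).indicator
      (fun _ => min (1 / (b - a)) (spacingHeight s i)) x ≤
      (Set.Ioc a b).indicator (fun x => min (1 / (b - a)) (spacingDensity s x)) x := by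
    intro x
    by_cases hx : ∃ i ∈ Finset.Ico 1 s.card, x ∈ Set.Ioc (gridPoint s i) (gridPoint s (i + 1))
    · obtain ⟨i, hi, hxi⟩ := hx
      have hi' := Finset.mem_Ico.1 hi
      rw [Finset.sum_eq_single_of_mem i hi, Set.indicator_of_mem hxi, Set.indicator_of_mem]
      · refine min_le_min le_rfl ?_
        rw [spacingDensity_eq]
        refine le_trans (le_of_eq ?_) (Finset.single_le_sum
          (f := fun i => (Set.Ioc (gridPoint s i) (gridPoint s (i + 1))).indicator
            (fun _ => spacingHeight s i) x)
          (fun j _ => Set.indicator_nonneg (fun _ _ => spacingHeight_nonneg s j) x)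
          (Finset.mem_range.2 (show i < s.card + 1 by omega)))
        simp only [Set.indicator_of_mem hxi]
      · exact ⟨(hin i hi'.1 hi'.2.le).1.trans_lt hxi.1,
          hxi.2.trans (hin (i + 1) (by omega) (by omega)).2⟩
      · intro j hj hji
        have hj' := Finset.mem_Ico.1 hj
        refine Set.indicator_of_notMem (fun hxj => ?_) _
        rcases lt_or_gt_of_ne hji with h | h
        · exact absurd (hmono (j + 1) i (by omega) h hi'.2.le) (not_le.2 (hxi.1.trans_le hxj.2))
        · exact absurd (hmono (i + 1) j (by omega) h hj'.2.le) (not_le.2 (hxj.1.trans_le hxi.2))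
    · push Not at hx
      rw [Finset.sum_eq_zero fun i hi => Set.indicator_of_notMem (hx i hi) _]
      exact Set.indicator_nonneg (fun y _ => le_min (by positivity) (spacingDensity_nonneg s y)) x
  rw [← integral_Ioc_eq_integral_Ioo, ← integral_indicator measurableSet_Ioc]
  have hint : Integrable ((Set.Ioc a b).indicator
      fun x => min (1 / (b - a)) (spacingDensity s x)) := by
    refine ((integrable_spacingDensity s).mono' ?_ ?_).indicator measurableSet_Ioc
    · exact (measurable_const.min (measurable_spacingDensity s)).aestronglyMeasurable
    · refine ae_of_all _ fun x => ?_
      rw [Real.norm_of_nonneg (le_min (by positivity) (spacingDensity_nonneg s x))]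
      exact min_le_right _ _
  refine le_trans ?_ (integral_mono
    (integrable_finsetSum _ fun i _ => integrable_indicator_Ioc_const _ _ _) hint key)
  rw [integral_finsetSum _ fun i _ => integrable_indicator_Ioc_const _ _ _]
  refine Finset.sum_le_sum fun i hi => ?_
  have hi' := Finset.mem_Ico.1 hi
  rw [integral_indicator_Ioc_const]
  set Δ := gridPoint s (i + 1) - gridPoint s i with hΔ
  have hΔ0 : 0 ≤ Δ := by linarith [hstep i hi]
  rw [max_eq_left hΔ0]
  rcases hΔ0.eq_or_lt with h | h
  · rw [← h]; simp
  · have e : Δ * spacingHeight s i = 1 / s.card := by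
      have h1 := gridPoint_succ_sub hi'.1 hi'.2
      rw [← hΔ] at h1
      unfold spacingHeight
      have hD : orderStat s ((i : ℤ) + spacingParam s.card) -
          orderStat s ((i : ℤ) - spacingParam s.card) = Δ * (2 * spacingParam s.card) := by
        rw [h1]; field_simp
      rw [hD]; field_simp
    rw [mul_min_of_nonneg _ _ hΔ0, e, mul_one_div]

/-! ### From missing mass to intervals with too few points. -/

theorem sum_range_mul_eq {M : ℕ} (J : ℕ) (F : ℕ → ℝ) :
    ∑ k ∈ Finset.range (M * J), F k = ∑ r ∈ Finset.range M, ∑ j ∈ Finset.range J, F (r + M * j) := by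
  induction J with
  | zero => simp
  | succ J ih =>
    rw [Nat.mul_succ, Finset.sum_range_add, ih, ← Finset.sum_add_distrib]
    refine Finset.sum_congr rfl fun r _ => ?_
    rw [Finset.sum_range_succ, add_comm r]

/-- Averaging over residue classes: some class of consecutive windows of `M` steps of a bounded
sequence has long windows which account for the defect of the truncated sum of window lengths. -/
theorem exists_class_sum_min {y : ℕ → ℝ} (hy : Monotone y) {a b : ℝ} (hab : a < b) {M N : ℕ}
    (hM : 0 < M) (ha : ∀ k < M, y k = a) (hb : ∀ k, N + M ≤ k → y k = b) :
    ∃ (T : Finset ℕ) (r : ℕ), (T.card : ℝ) ≤ N / M ∧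
      (N : ℝ) - ∑ k ∈ Finset.range (M * (N + 1)), min (N / (M * (b - a)) * (y (k + M) - y k)) 1 ≤
        N * (∑ j ∈ T, (y (r + M * (j + 1)) - y (r + M * j))) / (b - a) - M * T.card := by
  have hw : 0 < b - a := by linarith
  have hM' : (0 : ℝ) < M := by exact_mod_cast hM
  set c : ℝ := N / (M * (b - a)) with hc
  have hc0 : 0 ≤ c := by positivity
  -- The windows of class `r` on which the truncation at `1` is active.
  set T : ℕ → Finset ℕ := fun r =>
    (Finset.range (N + 1)).filter fun j => 1 < c * (y (r + M * (j + 1)) - y (r + M * j)) with hT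
  -- Each class telescopes from a value `a` to a value `b`, so its untruncated sum does not depend
  -- on `r`.
  have htel : ∀ r ∈ Finset.range M, ∑ j ∈ Finset.range (N + 1),
      c * (y (r + M * (j + 1)) - y (r + M * j)) = N / M := by
    intro r hr
    rw [← Finset.mul_sum, Finset.sum_range_sub (fun j => y (r + M * j)), ha (r + M * 0) (by simpa using hr),
      hb (r + M * (N + 1)) (by nlinarith), hc]
    field_simp
  have hd0 : ∀ k l, k ≤ l → 0 ≤ c * (y l - y k) := fun k l h =>
    mul_nonneg hc0 (by linarith [hy h])
  have hcls : ∀ r ∈ Finset.range M, ∑ j ∈ Finset.range (N + 1),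
      min (c * (y (r + M * j + M) - y (r + M * j))) 1 =
        N / M - ∑ j ∈ T r, (c * (y (r + M * (j + 1)) - y (r + M * j)) - 1) := by
    intro r hr
    rw [← htel r hr, hT, Finset.sum_filter, ← Finset.sum_sub_distrib]
    refine Finset.sum_congr rfl fun j _ => ?_
    rw [show r + M * j + M = r + M * (j + 1) by ring]
    split_ifs with h
    · rw [min_eq_right h.le]; ring
    · rw [min_eq_left (not_lt.1 h)]; ring
  have hsum := sum_range_mul_eq (M := M) (N + 1) fun k => min (c * (y (k + M) - y k)) 1
  -- Some class has a truncated sum not above the average over the `M` classes.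
  obtain ⟨r, hr, hle⟩ := Finset.exists_le_of_sum_le (s := Finset.range M)
    (f := fun r => ∑ j ∈ Finset.range (N + 1), min (c * (y (r + M * j + M) - y (r + M * j))) 1)
    (g := fun _ => (∑ k ∈ Finset.range (M * (N + 1)), min (c * (y (k + M) - y k)) 1) / M)
    ⟨0, by simpa using hM⟩ (by
      rw [hsum, Finset.sum_const, Finset.card_range, nsmul_eq_mul]
      apply le_of_eq
      field_simp)
  refine ⟨T r, r, ?_, ?_⟩
  · calc ((T r).card : ℝ) = ∑ j ∈ T r, 1 := by simp
      _ ≤ ∑ j ∈ T r, c * (y (r + M * (j + 1)) - y (r + M * j)) :=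
          Finset.sum_le_sum fun j hj => (Finset.mem_filter.1 hj).2.le
      _ ≤ ∑ j ∈ Finset.range (N + 1), c * (y (r + M * (j + 1)) - y (r + M * j)) :=
          Finset.sum_le_sum_of_subset_of_nonneg (Finset.filter_subset _ _) fun j _ _ =>
            hd0 _ _ (by gcongr; omega)
      _ = N / M := htel r hr
  · rw [hcls r hr, Finset.sum_sub_distrib, ← Finset.mul_sum, Finset.sum_const, nsmul_eq_mul,
      le_div_iff₀ hM'] at hle
    set X := ∑ j ∈ T r, (y (r + M * (j + 1)) - y (r + M * j))
    have e : (N / M - (c * X - (T r).card * 1)) * M = N - N * X / (b - a) + M * (T r).card := by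
      rw [hc]; field_simp; ring
    linarith

/-- The number of points of a finite sample in a set, as a real number. -/
noncomputable def pointCount {α : Type*} (S : Multiset α) (B : Set α) : ℝ :=
  (S.map (B.indicator fun _ => (1 : ℝ))).sum

/-- The order statistics of a sample from `[a, b]`, continued by `a` below and by `b` above. -/
noncomputable def extOrderStat (s : Multiset ℝ) (a b : ℝ) (i : ℤ) : ℝ :=
  if i < 1 then a else if s.card < i then b else orderStat s i

theorem extOrderStat_mono {s : Multiset ℝ} {a b : ℝ} (hs : 0 < s.card)
    (hmem : ∀ x ∈ s, x ∈ Set.Icc a b) (hab : a ≤ b) : Monotone (extOrderStat s a b) := by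
  intro i j hij
  unfold extOrderStat
  have h1 := hmem _ (orderStat_mem hs i)
  have h2 := hmem _ (orderStat_mem hs j)
  have h3 := orderStat_mono s hij
  split_ifs <;> first | omega | exact le_rfl | exact hab | exact h3 | exact h1.2 | exact h2.1

theorem extOrderStat_mem {s : Multiset ℝ} {a b : ℝ} (hs : 0 < s.card)
    (hmem : ∀ x ∈ s, x ∈ Set.Icc a b) (hab : a ≤ b) (i : ℤ) :
    extOrderStat s a b i ∈ Set.Icc a b := by
  unfold extOrderStat
  split_ifs
  · exact ⟨le_rfl, hab⟩
  · exact ⟨hab, le_rfl⟩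
  · exact hmem _ (orderStat_mem hs i)

/-- Only ranks strictly between `i` and `i + M` can give points of the open interval. Taking it open
makes this hold also when order statistics coincide. -/
theorem pointCount_Ioo_extOrderStat_le {s : Multiset ℝ} {a b : ℝ} (hs : 0 < s.card)
    (hmem : ∀ x ∈ s, x ∈ Set.Icc a b) (hab : a ≤ b) (i : ℤ) (M : ℕ) :
    pointCount s (Set.Ioo (extOrderStat s a b i) (extOrderStat s a b (i + M))) ≤ M := by
  classical
  set B := Set.Ioo (extOrderStat s a b i) (extOrderStat s a b (i + M)) with hB
  have h1 : pointCount s B = ∑ k ∈ Finset.range s.card,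
      B.indicator (fun _ => (1 : ℝ)) (orderStat s ((k : ℤ) + 1)) := by
    conv_lhs => rw [pointCount, ← map_range_orderStat s, Multiset.map_map]
    rfl
  have h2 : ((Finset.range s.card).filter fun k : ℕ => orderStat s ((k : ℤ) + 1) ∈ B).card ≤ M := by
    have : (Finset.Ioo i (i + M)).card ≤ M := by rw [Int.card_Ioo]; omega
    refine le_trans (Finset.card_le_card_of_injOn (fun k : ℕ => (k : ℤ) + 1) ?_ ?_) this
    · intro k hk
      obtain ⟨hk, hkB⟩ := Finset.mem_filter.1 hk
      have hk := Finset.mem_range.1 hk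
      have e : orderStat s ((k : ℤ) + 1) = extOrderStat s a b ((k : ℤ) + 1) := by
        rw [extOrderStat, if_neg (by omega), if_neg (by omega)]
      rw [e, hB, Set.mem_Ioo] at hkB
      have hm := extOrderStat_mono hs hmem hab
      exact Finset.mem_coe.2 (Finset.mem_Ioo.2 ⟨hm.reflect_lt hkB.1, hm.reflect_lt hkB.2⟩)
    · intro k _ l _ h
      simpa using h
  rw [h1]
  simp only [Set.indicator_apply]
  rw [Finset.sum_boole]
  exact_mod_cast h2

/-- The mass which the spacing density of a sample in `[a, b]` misses, when compared with the
uniform density, is controlled by the deficit of the sample in a union of few intervals. -/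
theorem exists_sparse_intervals {s : Multiset ℝ} {a b : ℝ} (hs : 0 < s.card)
    (hmem : ∀ x ∈ s, x ∈ Set.Icc a b) (hab : a < b) :
    ∃ (T : Finset ℕ) (lo hi : ℕ → ℝ), (T.card : ℝ) ≤ Real.sqrt s.card ∧
      (∀ j ∈ T, a ≤ lo j ∧ lo j ≤ hi j ∧ hi j ≤ b) ∧
      (T : Set ℕ).PairwiseDisjoint (fun j => Set.Ioo (lo j) (hi j)) ∧
      s.card * (1 - ∫ x in Set.Ioo a b, min (1 / (b - a)) (spacingDensity s x)) ≤
        4 * spacingParam s.card + s.card * (∑ j ∈ T, (hi j - lo j)) / (b - a) -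
          ∑ j ∈ T, pointCount s (Set.Ioo (lo j) (hi j)) := by
  have hw : 0 < b - a := by linarith
  have hN : (0 : ℝ) < s.card := by exact_mod_cast hs
  have hm := spacingParam_pos hs
  have hI := sum_Ico_min_le_integral hs hmem hab
  have hsq := sqrt_le_two_mul_spacingParam hs
  set m := spacingParam s.card with hmdef
  set N := s.card with hNdef
  have hm' : (0 : ℝ) < m := by exact_mod_cast hm
  -- The shift makes the first `2 * m` terms equal to `a` and all terms from `N + 2 * m` on equal to
  -- `b`, as the averaging over classes requires.
  set y : ℕ → ℝ := fun k => extOrderStat s a b (1 - 2 * m + k) with hy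
  have hymono : Monotone y := fun k l h => extOrderStat_mono hs hmem hab.le (by omega)
  obtain ⟨T, r, hT, hmain⟩ := exists_class_sum_min (M := 2 * m) (N := N) hymono hab (by omega)
    (fun k hk => by simp only [hy]; rw [extOrderStat, if_pos (by omega)])
    (fun k hk => by simp only [hy]; rw [extOrderStat, if_neg (by omega), if_pos (by omega)])
  refine ⟨T, fun j => y (r + 2 * m * j), fun j => y (r + 2 * m * (j + 1)), ?_, ?_, ?_, ?_⟩
  · refine hT.trans ?_
    rw [div_le_iff₀ (by positivity)]
    calc (N : ℝ) = Real.sqrt N * Real.sqrt N := (Real.mul_self_sqrt hN.le).symm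
      _ ≤ Real.sqrt N * (2 * m : ℕ) := by push_cast; gcongr
  · intro j _
    exact ⟨(extOrderStat_mem hs hmem hab.le _).1, hymono (by gcongr; omega),
      (extOrderStat_mem hs hmem hab.le _).2⟩
  · intro j _ l _ hjl
    rcases lt_or_gt_of_ne hjl with h | h
    · refine Set.disjoint_left.2 fun x hx hx' => ?_
      have : y (r + 2 * m * (j + 1)) ≤ y (r + 2 * m * l) := hymono (by gcongr; omega)
      exact absurd (hx.2.trans_le this) (not_lt.2 hx'.1.le)
    · refine Set.disjoint_left.2 fun x hx hx' => ?_
      have : y (r + 2 * m * (l + 1)) ≤ y (r + 2 * m * j) := hymono (by gcongr; omega)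
      exact absurd (hx'.2.trans_le this) (not_lt.2 hx.1.le)
  -- A selected window has at most `2 * m` points, so the term `-M * T.card` of the averaging bound
  -- may be replaced by minus the counts.
  have hcount : ∑ j ∈ T, pointCount s (Set.Ioo (y (r + 2 * m * j)) (y (r + 2 * m * (j + 1)))) ≤
      ((2 * m : ℕ) : ℝ) * T.card := by
    rw [mul_comm ((2 * m : ℕ) : ℝ), ← nsmul_eq_mul]
    refine Finset.sum_le_card_nsmul T
      (fun j => pointCount s (Set.Ioo (y (r + 2 * m * j)) (y (r + 2 * m * (j + 1))))) _ fun j _ => ?_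
    have := pointCount_Ioo_extOrderStat_le hs hmem hab.le
      (1 - 2 * m + (r + 2 * m * j : ℕ)) (2 * m)
    have e : (1 - 2 * m + (r + 2 * m * (j + 1) : ℕ) : ℤ) =
        1 - 2 * m + (r + 2 * m * j : ℕ) + (2 * m : ℕ) := by push_cast; ring
    simp only [hy, e]
    exact this
  -- Windows of genuine order statistics, `2 * m ≤ k < N`, are grid steps with index `k - m + 1`. At
  -- most `4 * m` of the others are nonzero, and each is at most `1`.
  have hwin : ∑ k ∈ Finset.range (2 * m * (N + 1)),
      min (N / ((2 * m : ℕ) * (b - a)) * (y (k + 2 * m) - y k)) 1 ≤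
      4 * m + N * ∑ i ∈ Finset.Ico 1 N,
        min ((gridPoint s (i + 1) - gridPoint s i) / (b - a)) (1 / N) := by
    have hd0 : ∀ k, 0 ≤ min ((N : ℝ) / ((2 * m : ℕ) * (b - a)) * (y (k + 2 * m) - y k)) 1 :=
      fun k => le_min (mul_nonneg (by positivity) (by linarith [hymono (show k ≤ k + 2 * m by omega)]))
        zero_le_one
    have hle1 : ∀ k, min ((N : ℝ) / ((2 * m : ℕ) * (b - a)) * (y (k + 2 * m) - y k)) 1 ≤ 1 :=
      fun k => min_le_right _ _
    have hz : ∀ k ≥ N + 2 * m,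
        min ((N : ℝ) / ((2 * m : ℕ) * (b - a)) * (y (k + 2 * m) - y k)) 1 = 0 := by
      intro k hk
      have h1 : y k = b := by
        simp only [hy]; rw [extOrderStat, if_neg (by omega), if_pos (by omega)]
      have h2 : y (k + 2 * m) = b := by
        simp only [hy]; rw [extOrderStat, if_neg (by omega), if_pos (by omega)]
      rw [h1, h2]; simp
    have hin : ∀ k ∈ Finset.Ico (2 * m) N,
        min ((N : ℝ) / ((2 * m : ℕ) * (b - a)) * (y (k + 2 * m) - y k)) 1 =
        N * min ((gridPoint s (k - m + 1 + 1) - gridPoint s (k - m + 1)) / (b - a)) (1 / N) := by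
      intro k hk
      have hk' := Finset.mem_Ico.1 hk
      have h1 : y k = orderStat s (((k - m + 1 : ℕ) : ℤ) - m) := by
        simp only [hy]; rw [extOrderStat, if_neg (by omega), if_neg (by omega)]
        congr 1; omega
      have h2 : y (k + 2 * m) = orderStat s (((k - m + 1 : ℕ) : ℤ) + m) := by
        simp only [hy]; rw [extOrderStat, if_neg (by omega), if_neg (by omega)]
        congr 1; omega
      rw [gridPoint_succ_sub (by omega) (by omega), ← hNdef, ← hmdef, mul_min_of_nonneg _ _ hN.le, h1, h2,
        mul_one_div_cancel hN.ne']
      congr 1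
      push_cast
      field_simp
    have hsub : ∀ k ∈ Finset.range (2 * m * (N + 1)),
        min ((N : ℝ) / ((2 * m : ℕ) * (b - a)) * (y (k + 2 * m) - y k)) 1 ≤
        (if k ∈ Finset.range (2 * m) then 1 else 0) +
        (if k ∈ Finset.Ico N (N + 2 * m) then 1 else 0) +
        (if k ∈ Finset.Ico (2 * m) N then
          N * min ((gridPoint s (k - m + 1 + 1) - gridPoint s (k - m + 1)) / (b - a)) (1 / N)
          else 0) := by
      intro k _
      by_cases h3 : k ∈ Finset.Ico (2 * m) N
      · rw [if_pos h3, ← hin k h3]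
        have : (0 : ℝ) ≤ (if k ∈ Finset.range (2 * m) then 1 else 0) := by split_ifs <;> simp
        have : (0 : ℝ) ≤ (if k ∈ Finset.Ico N (N + 2 * m) then 1 else 0) := by split_ifs <;> simp
        linarith
      · rw [if_neg h3]
        by_cases h1 : k ∈ Finset.range (2 * m)
        · rw [if_pos h1]
          have : (0 : ℝ) ≤ (if k ∈ Finset.Ico N (N + 2 * m) then 1 else 0) := by split_ifs <;> simp
          linarith [hle1 k]
        · by_cases h2 : k ∈ Finset.Ico N (N + 2 * m)
          · rw [if_pos h2, if_neg h1]
            linarith [hle1 k]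
          · rw [if_neg h2, if_neg h1, hz k (by simp at h1 h2 h3; omega)]
            simp
    refine (Finset.sum_le_sum hsub).trans ?_
    rw [Finset.sum_add_distrib, Finset.sum_add_distrib]
    have b1 : ∑ k ∈ Finset.range (2 * m * (N + 1)),
        (if k ∈ Finset.range (2 * m) then (1 : ℝ) else 0) ≤ 2 * m := by
      rw [Finset.sum_boole]
      have : ((Finset.range (2 * m * (N + 1))).filter fun k => k ∈ Finset.range (2 * m)).card
          ≤ 2 * m := by
        refine (Finset.card_le_card fun k hk => (Finset.mem_filter.1 hk).2).trans (by simp)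
      exact_mod_cast this
    have b2 : ∑ k ∈ Finset.range (2 * m * (N + 1)),
        (if k ∈ Finset.Ico N (N + 2 * m) then (1 : ℝ) else 0) ≤ 2 * m := by
      rw [Finset.sum_boole]
      have : ((Finset.range (2 * m * (N + 1))).filter fun k => k ∈ Finset.Ico N (N + 2 * m)).card
          ≤ 2 * m := by
        refine (Finset.card_le_card fun k hk => (Finset.mem_filter.1 hk).2).trans (by simp)
      exact_mod_cast this
    have hg0 : ∀ i ∈ Finset.Ico 1 N,
        0 ≤ min ((gridPoint s (i + 1) - gridPoint s i) / (b - a)) (1 / (N : ℝ)) := by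
      intro i hi
      rw [gridPoint_succ_sub (Finset.mem_Ico.1 hi).1 (Finset.mem_Ico.1 hi).2]
      have h3 := orderStat_mono s (i := (i : ℤ) - m) (j := (i : ℤ) + m) (by omega)
      refine le_min (div_nonneg (div_nonneg (by linarith) (by positivity)) hw.le) (by positivity)
    have b3 : ∑ k ∈ Finset.range (2 * m * (N + 1)), (if k ∈ Finset.Ico (2 * m) N then
          N * min ((gridPoint s (k - m + 1 + 1) - gridPoint s (k - m + 1)) / (b - a)) (1 / (N : ℝ))
          else 0) ≤ N * ∑ i ∈ Finset.Ico 1 N,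
        min ((gridPoint s (i + 1) - gridPoint s i) / (b - a)) (1 / N) := by
      rw [← Finset.sum_filter, ← Finset.mul_sum]
      refine mul_le_mul_of_nonneg_left ?_ hN.le
      have hinj : Set.InjOn (fun k => k - m + 1)
          ((Finset.range (2 * m * (N + 1))).filter fun k => k ∈ Finset.Ico (2 * m) N) := by
        intro k hk l hl h
        simp at hk hl h
        omega
      rw [← Finset.sum_image (f := fun i =>
        min ((gridPoint s (i + 1) - gridPoint s i) / (b - a)) (1 / (N : ℝ))) hinj]
      refine Finset.sum_le_sum_of_subset_of_nonneg (fun i hi => ?_) fun i hi _ => hg0 i hi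
      obtain ⟨k, hk, rfl⟩ := Finset.mem_image.1 hi
      simp at hk ⊢
      omega
    linarith
  have h5 := mul_le_mul_of_nonneg_left hI hN.le
  linarith

/-! ### Uniform one-sided deviations of the empirical measure. -/

theorem pointCount_firstSample {Ω : Type*} (Z : ℕ → Ω → ℝ × ℝ) (n : ℕ) (ω : Ω) (B : Set (ℝ × ℝ)) :
    pointCount (firstSample Z n ω) B =
      ∑ i ∈ Finset.range n, B.indicator (fun _ => (1 : ℝ)) (Z i ω) := by
  rw [pointCount, firstSample, Multiset.map_map]
  rfl

section Hoeffding

variable {Ω : Type*} [MeasurableSpace Ω] {P : Measure Ω} [IsProbabilityMeasure P]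
  {Z : ℕ → Ω → ℝ × ℝ} {ν : Measure (ℝ × ℝ)}

/-- Hoeffding's inequality: the centred indicator has range of length `1`, hence sub-Gaussian
parameter `1 / 4`. -/
theorem measureReal_deficit_le (hZ : ∀ i, Measurable (Z i)) (hind : iIndepFun Z P)
    (hlaw : ∀ i, P.map (Z i) = ν) {W : Set (ℝ × ℝ)} (hW : MeasurableSet W) {ε : ℝ} (hε : 0 ≤ ε)
    (n : ℕ) :
    P.real {ω | n * ε ≤ n * ν.real W - pointCount (firstSample Z n ω) W} ≤
      Real.exp (-(2 * ε ^ 2 * n)) := by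
  rcases Nat.eq_zero_or_pos n with rfl | hn
  · simp
  have hn' : (0 : ℝ) < n := by exact_mod_cast hn
  set g : ℝ × ℝ → ℝ := fun z => ν.real W - W.indicator (fun _ => (1 : ℝ)) z with hg
  have hgm : Measurable g := measurable_const.sub (measurable_const.indicator hW)
  have hsub : ∀ i ∈ Finset.range n,
      HasSubgaussianMGF (g ∘ Z i) ((fun _ => 1 / 4 : ℕ → NNReal) i) P := by
    intro i _
    have hm : Measurable fun ω => -W.indicator (fun _ => (1 : ℝ)) (Z i ω) :=
      ((measurable_const.indicator hW).comp (hZ i)).neg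
    have h := hasSubgaussianMGF_of_mem_Icc (μ := P) (a := -1) (b := 0) hm.aemeasurable
      (ae_of_all _ fun ω => by
        by_cases h : Z i ω ∈ W <;> simp [h])
    have hint : ∫ ω, -W.indicator (fun _ => (1 : ℝ)) (Z i ω) ∂P = -ν.real W := by
      rw [integral_neg, ← integral_map (φ := Z i) (f := W.indicator fun _ => (1 : ℝ))
        (hZ i).aemeasurable (measurable_const.indicator hW).aestronglyMeasurable, hlaw i,
        integral_indicator_const _ hW]
      simp
    rw [hint] at h
    convert h using 1
    · funext ω; simp [hg]; ring
    · ext; simp; norm_num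
  have hH := HasSubgaussianMGF.measure_sum_ge_le_of_iIndepFun
    (hind.comp (fun _ => g) fun _ => hgm) hsub (ε := n * ε) (by positivity)
  have hset : {ω | n * ε ≤ n * ν.real W - pointCount (firstSample Z n ω) W} =
      {ω | n * ε ≤ ∑ i ∈ Finset.range n, (g ∘ Z i) ω} := by
    ext ω
    simp [hg, pointCount_firstSample]
  rw [hset]
  refine hH.trans (le_of_eq ?_)
  congr 1
  simp
  field_simp
  ring

/-- Union bound and Borel–Cantelli. The Hoeffding exponent is `2 * ε ^ 2 * n`; the size of the
family uses up half of it, and the remaining half makes the bad probabilities summable in spite of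
the polynomial factor. -/
theorem ae_eventually_deficit_lt (hZ : ∀ i, Measurable (Z i)) (hind : iIndepFun Z P)
    (hlaw : ∀ i, P.map (Z i) = ν) {ι : Type*} (I : ℕ → Finset ι) {W : ι → Set (ℝ × ℝ)}
    (hW : ∀ i, MeasurableSet (W i)) {ε : ℝ} (hε : 0 < ε)
    (hI : ∀ n, ((I n).card : ℝ) ≤ (n + 1) ^ 2 * Real.exp (ε ^ 2 * n)) :
    ∀ᵐ ω ∂P, ∀ᶠ n in atTop, ∀ i ∈ I n,
      n * ν.real (W i) - pointCount (firstSample Z n ω) (W i) < n * ε := by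
  set bad : ℕ → Set Ω := fun n =>
    ⋃ i ∈ I n, {ω | n * ε ≤ n * ν.real (W i) - pointCount (firstSample Z n ω) (W i)} with hbad
  have hb : ∀ n, P (bad n) ≤ ENNReal.ofReal ((n + 1) ^ 2 * Real.exp (-ε ^ 2 * n)) := by
    intro n
    rw [← ofReal_measureReal (measure_ne_top P _)]
    refine ENNReal.ofReal_le_ofReal ?_
    calc P.real (bad n) ≤ ∑ i ∈ I n, Real.exp (-(2 * ε ^ 2 * n)) :=
          (measureReal_biUnion_finset_le _ _).trans
            (Finset.sum_le_sum fun i _ => measureReal_deficit_le hZ hind hlaw (hW i) hε.le n)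
      _ ≤ (n + 1) ^ 2 * Real.exp (ε ^ 2 * n) * Real.exp (-(2 * ε ^ 2 * n)) := by
          rw [Finset.sum_const, nsmul_eq_mul]
          gcongr
          exact hI n
      _ = (n + 1) ^ 2 * Real.exp (-ε ^ 2 * n) := by
          rw [mul_assoc, ← Real.exp_add]
          congr 2; ring
  have hsum : Summable fun n : ℕ => ((n : ℝ) + 1) ^ 2 * Real.exp (-ε ^ 2 * n) := by
    have h2 := Real.summable_pow_mul_exp_neg_nat_mul 2 (r := ε ^ 2) (by positivity)
    have h1 := Real.summable_pow_mul_exp_neg_nat_mul 1 (r := ε ^ 2) (by positivity)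
    have h0 := Real.summable_pow_mul_exp_neg_nat_mul 0 (r := ε ^ 2) (by positivity)
    refine ((h2.add (h1.mul_left 2)).add h0).congr fun n => ?_
    ring
  have hfin : ∑' n, P (bad n) ≠ ⊤ :=
    ne_top_of_le_ne_top hsum.tsum_ofReal_ne_top (ENNReal.tsum_le_tsum hb)
  filter_upwards [ae_eventually_notMem hfin] with ω hω
  filter_upwards [hω] with n hn i hi
  by_contra! hcon
  exact hn (Set.mem_biUnion hi hcon)

/-- The dyadic rectangle of size `2 ^ (-j) × 2 ^ (-k)` with index `q`. -/
def dyadicCell (j k : ℕ) (q : ℤ × ℤ) : Set (ℝ × ℝ) :=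
  Set.Ico ((q.1 : ℝ) / 2 ^ j) ((q.1 + 1) / 2 ^ j) ×ˢ Set.Ico ((q.2 : ℝ) / 2 ^ k) ((q.2 + 1) / 2 ^ k)

/-- The indices of the dyadic rectangles in `[-R, R) ^ 2`. -/
noncomputable def dyadicBox (R j k : ℕ) : Finset (ℤ × ℤ) :=
  Finset.Ico (-(R * 2 ^ j) : ℤ) (R * 2 ^ j) ×ˢ Finset.Ico (-(R * 2 ^ k) : ℤ) (R * 2 ^ k)

theorem measurableSet_dyadicCell (j k : ℕ) (q : ℤ × ℤ) : MeasurableSet (dyadicCell j k q) :=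
  measurableSet_Ico.prod measurableSet_Ico

theorem card_dyadicBox (R j k : ℕ) : ((dyadicBox R j k).card : ℝ) = 4 * R ^ 2 * 2 ^ (j + k) := by
  rw [dyadicBox, Finset.card_product, Int.card_Ico, Int.card_Ico]
  have h : ∀ i : ℕ, ((R * 2 ^ i : ℤ) - -(R * 2 ^ i : ℤ)).toNat = 2 * (R * 2 ^ i) := by
    intro i
    zify
    rw [Int.toNat_of_nonneg (by have : (0 : ℤ) ≤ R * 2 ^ i := by positivity
                                omega)]
    ring
  rw [h, h]
  push_cast
  ring

/-- A mesh has `4 * R ^ 2 * 2 ^ (j + k)` rectangles in the box, so the number of unions is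
exponential in a small multiple of `n`. The factor `(n + 1) ^ 2` in the union bound pays for the
choice of `j` and `k`. -/
theorem ae_eventually_dyadic_deficit_lt (hZ : ∀ i, Measurable (Z i)) (hind : iIndepFun Z P)
    (hlaw : ∀ i, P.map (Z i) = ν) (R : ℕ) (hR : 0 < R) {ε : ℝ} (hε : 0 < ε) :
    ∃ θ > 0, ∀ᵐ ω ∂P, ∀ᶠ n : ℕ in atTop, ∀ j k : ℕ, (2 : ℝ) ^ (j + k) ≤ θ * n →
      ∀ S ⊆ dyadicBox R j k, n * ν.real (⋃ q ∈ S, dyadicCell j k q) -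
        pointCount (firstSample Z n ω) (⋃ q ∈ S, dyadicCell j k q) < n * ε := by
  have hR' : (0 : ℝ) < R := by exact_mod_cast hR
  -- The second entry makes the number of unions at most `exp (ε ^ 2 * n)`. The entry `1` forces `j
  -- + k ≤ n`, so that only finitely many meshes occur for each `n`.
  set θ : ℝ := min 1 (ε ^ 2 / (4 * R ^ 2)) with hθ
  have hθ0 : 0 < θ := by positivity
  refine ⟨θ, hθ0, ?_⟩
  set I : ℕ → Finset (Σ _ : ℕ × ℕ, Finset (ℤ × ℤ)) := fun n =>
    ((Finset.range (n + 1) ×ˢ Finset.range (n + 1)).filter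
      fun p => (2 : ℝ) ^ (p.1 + p.2) ≤ θ * n).sigma fun p => (dyadicBox R p.1 p.2).powerset with hI
  have hcard : ∀ n, ((I n).card : ℝ) ≤ (n + 1) ^ 2 * Real.exp (ε ^ 2 * n) := by
    intro n
    rw [hI, Finset.card_sigma]
    push_cast
    have h1 : ∀ p ∈ (Finset.range (n + 1) ×ˢ Finset.range (n + 1)).filter
        (fun p => (2 : ℝ) ^ (p.1 + p.2) ≤ θ * n),
        (((dyadicBox R p.1 p.2).powerset.card : ℕ) : ℝ) ≤ Real.exp (ε ^ 2 * n) := by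
      intro p hp
      have hp := (Finset.mem_filter.1 hp).2
      rw [Finset.card_powerset]
      push_cast
      have h2 : (2 : ℝ) ≤ Real.exp 1 := by linarith [Real.add_one_le_exp (1 : ℝ)]
      calc (2 : ℝ) ^ (dyadicBox R p.1 p.2).card ≤ Real.exp 1 ^ (dyadicBox R p.1 p.2).card := by
            gcongr
        _ = Real.exp (dyadicBox R p.1 p.2).card := by rw [← Real.exp_nat_mul, mul_one]
        _ ≤ Real.exp (ε ^ 2 * n) := by
            rw [card_dyadicBox]
            refine Real.exp_le_exp.2 ?_
            have h3 : θ ≤ ε ^ 2 / (4 * R ^ 2) := min_le_right _ _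
            calc 4 * (R : ℝ) ^ 2 * 2 ^ (p.1 + p.2) ≤ 4 * R ^ 2 * (ε ^ 2 / (4 * R ^ 2) * n) := by
                  gcongr; exact hp.trans (by gcongr)
              _ = ε ^ 2 * n := by field_simp
    refine (Finset.sum_le_card_nsmul _ _ _ h1).trans ?_
    rw [nsmul_eq_mul]
    gcongr
    have h4 := Finset.card_filter_le (Finset.range (n + 1) ×ˢ Finset.range (n + 1))
      fun p => (2 : ℝ) ^ (p.1 + p.2) ≤ θ * n
    rw [Finset.card_product, Finset.card_range, ← sq] at h4
    exact_mod_cast h4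
  have hmain := ae_eventually_deficit_lt hZ hind hlaw I
    (W := fun p => ⋃ q ∈ p.2, dyadicCell p.1.1 p.1.2 q)
    (fun p => Finset.measurableSet_biUnion _ fun q _ => measurableSet_dyadicCell _ _ _) hε hcard
  filter_upwards [hmain] with ω hω
  filter_upwards [hω] with n hn j k hjk S hS
  refine hn ⟨(j, k), S⟩ ?_
  have hle : j + k ≤ n := by
    have h1 : (2 : ℝ) ^ (j + k) ≤ n := hjk.trans
      (mul_le_of_le_one_left (by positivity) (min_le_left _ _))
    have h2 : 2 ^ (j + k) ≤ n := by exact_mod_cast h1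
    exact (Nat.lt_two_pow_self).le.trans h2
  simp only [hI, Finset.mem_sigma, Finset.mem_filter, Finset.mem_product, Finset.mem_range,
    Finset.mem_powerset]
  exact ⟨⟨⟨by omega, by omega⟩, hjk⟩, hS⟩

end Hoeffding

/-! ### Deficits of families of boxes and the total missing mass. -/

theorem pointCount_nonneg {α : Type*} (S : Multiset α) (B : Set α) : 0 ≤ pointCount S B := by
  refine Multiset.sum_nonneg fun x hx => ?_
  obtain ⟨y, -, rfl⟩ := Multiset.mem_map.1 hx
  exact Set.indicator_nonneg (fun _ _ => zero_le_one) y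

theorem pointCount_le_sum {α ι : Type*} (S : Multiset α) {F : Finset ι} {B : Set α} {D : ι → Set α}
    (h : B ⊆ ⋃ i ∈ F, D i) : pointCount S B ≤ ∑ i ∈ F, pointCount S (D i) := by
  unfold pointCount
  rw [← Multiset.sum_map_sum]
  refine Multiset.sum_map_le_sum_map _ _ fun x _ => ?_
  by_cases hx : x ∈ B
  · obtain ⟨i, hi, hxi⟩ := Set.mem_iUnion₂.1 (h hx)
    rw [Set.indicator_of_mem hx]
    refine le_trans (le_of_eq ?_) (Finset.single_le_sum
      (f := fun i => (D i).indicator (fun _ => (1 : ℝ)) x)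
      (fun j _ => Set.indicator_nonneg (fun _ _ => zero_le_one) x) hi)
    simp [hxi]
  · rw [Set.indicator_of_notMem hx]
    exact Finset.sum_nonneg fun j _ => Set.indicator_nonneg (fun _ _ => zero_le_one) x

theorem floor_mul_two_pow {x : ℝ} {j : ℕ} {a : ℤ}
    (hx : x ∈ Set.Ico ((a : ℝ) / 2 ^ j) ((a + 1) / 2 ^ j)) : ⌊x * 2 ^ j⌋ = a := by
  rw [Set.mem_Ico, div_le_iff₀ (by positivity), lt_div_iff₀ (by positivity)] at hx
  exact Int.floor_eq_iff.2 hx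

theorem disjoint_dyadicCell {j k : ℕ} {q q' : ℤ × ℤ} (h : q ≠ q') :
    Disjoint (dyadicCell j k q) (dyadicCell j k q') := by
  refine Set.disjoint_left.2 fun p hp hp' => h ?_
  exact Prod.ext ((floor_mul_two_pow hp.1).symm.trans (floor_mul_two_pow hp'.1))
    ((floor_mul_two_pow hp.2).symm.trans (floor_mul_two_pow hp'.2))

theorem volume_real_dyadicCell (j k : ℕ) (q : ℤ × ℤ) :
    volume.real (dyadicCell j k q) = (1 / 2 ^ j) * (1 / 2 ^ k) := by
  rw [dyadicCell, Measure.volume_eq_prod, measureReal_prod_prod, Real.volume_real_Ico,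
    Real.volume_real_Ico, ← sub_div, ← sub_div, add_sub_cancel_left, add_sub_cancel_left,
    max_eq_left (by positivity), max_eq_left (by positivity)]

theorem corner_mem_dyadicCell (j k : ℕ) (q : ℤ × ℤ) :
    ((q.1 : ℝ) / 2 ^ j, (q.2 : ℝ) / 2 ^ k) ∈ dyadicCell j k q := by
  refine ⟨⟨le_rfl, ?_⟩, ⟨le_rfl, ?_⟩⟩ <;> simp only <;> gcongr <;> linarith

/-- The indices of the dyadic intervals of length `2 ^ (-j)` inside `(x, y)`. -/
noncomputable def innerIndices (j : ℕ) (x y : ℝ) : Finset ℤ :=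
  Finset.Ico (⌊x * 2 ^ j⌋ + 1) (⌈y * 2 ^ j⌉ - 1)

theorem Ico_subset_Ioo_of_mem_innerIndices {j : ℕ} {x y : ℝ} {a : ℤ} (ha : a ∈ innerIndices j x y) :
    Set.Ico ((a : ℝ) / 2 ^ j) ((a + 1) / 2 ^ j) ⊆ Set.Ioo x y := by
  obtain ⟨h1, h2⟩ := Finset.mem_Ico.1 ha
  have h3 : x * 2 ^ j < a := Int.floor_lt.1 (by omega)
  have h4 : ((a + 1 : ℤ) : ℝ) < y * 2 ^ j := Int.lt_ceil.1 (by omega)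
  push_cast at h4
  intro z hz
  exact ⟨((lt_div_iff₀ (by positivity)).2 h3).trans_le hz.1,
    hz.2.trans ((div_lt_iff₀ (by positivity)).2 h4)⟩

theorem sub_le_card_innerIndices (j : ℕ) (x y : ℝ) :
    y - x - 2 * (1 / 2 ^ j) ≤ (innerIndices j x y).card * (1 / 2 ^ j) := by
  have h1 : ((⌈y * 2 ^ j⌉ - 1 - (⌊x * 2 ^ j⌋ + 1) : ℤ) : ℝ) ≤ (innerIndices j x y).card := by
    rw [innerIndices, Int.card_Ico]
    exact_mod_cast Int.self_le_toNat _
  push_cast at h1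
  have h2 := Int.floor_le (x * 2 ^ j)
  have h3 := Int.le_ceil (y * 2 ^ j)
  refine le_of_mul_le_mul_right ?_ (by positivity : (0 : ℝ) < 2 ^ j)
  rw [mul_assoc, one_div_mul_cancel (by positivity), mul_one]
  have : (y - x - 2 * (1 / 2 ^ j)) * 2 ^ j = y * 2 ^ j - x * 2 ^ j - 2 := by field_simp
  linarith

/-- If both reduced sides are nonnegative, multiply them and drop the positive cross term `4 * t *
τ`. If one is negative, the left-hand side is at most `0`. -/
theorem mul_sub_le_of_sub_le {l h t τ u v : ℝ} (hl : 0 ≤ l) (hh : 0 ≤ h) (ht : 0 ≤ t) (hτ : 0 ≤ τ)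
    (hu : 0 ≤ u) (hv : 0 ≤ v) (h1 : l - 2 * t ≤ u) (h2 : h - 2 * τ ≤ v) :
    l * h - (2 * t * h + 2 * τ * l) ≤ u * v := by
  rcases le_total l (2 * t) with h3 | h3
  · nlinarith [mul_nonneg hu hv, mul_nonneg hτ hl]
  rcases le_total h (2 * τ) with h4 | h4
  · nlinarith [mul_nonneg hu hv, mul_nonneg ht hh]
  · calc _ ≤ (l - 2 * t) * (h - 2 * τ) := by nlinarith [mul_nonneg ht hτ]
      _ ≤ u * v := mul_le_mul h1 h2 (by linarith) hu

/-- If the sample has small deficit in all unions of dyadic rectangles of a given size, then it has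
small total deficit in families of disjoint boxes which are not much thinner than these. -/
theorem sum_box_deficit_le {S : Multiset (ℝ × ℝ)} {f : ℝ × ℝ → ℝ} (hf : Integrable f)
    {R j k : ℕ} {n ε : ℝ} (hn : 0 ≤ n)
    (hdef : ∀ T ⊆ dyadicBox R j k,
      n * (∫ p in ⋃ q ∈ T, dyadicCell j k q, f p) -
        pointCount S (⋃ q ∈ T, dyadicCell j k q) ≤ n * ε)
    {ι : Type*} (F : Finset ι) {x₀ x₁ y₀ y₁ c : ι → ℝ} (hx : ∀ i ∈ F, x₀ i ≤ x₁ i)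
    (hy : ∀ i ∈ F, y₀ i ≤ y₁ i) (hc : ∀ i ∈ F, 0 ≤ c i)
    (hcf : ∀ i ∈ F, ∀ p ∈ Set.Ioo (x₀ i) (x₁ i) ×ˢ Set.Ioo (y₀ i) (y₁ i), c i ≤ f p)
    (hbox : ∀ i ∈ F, 0 < c i → Set.Ioo (x₀ i) (x₁ i) ×ˢ Set.Ioo (y₀ i) (y₁ i) ⊆
      Set.Ico (-R : ℝ) R ×ˢ Set.Ico (-R : ℝ) R)
    (hdisj : (F : Set ι).PairwiseDisjoint
      fun i => Set.Ioo (x₀ i) (x₁ i) ×ˢ Set.Ioo (y₀ i) (y₁ i)) :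
    ∑ i ∈ F, (n * (c i * ((x₁ i - x₀ i) * (y₁ i - y₀ i))) -
      pointCount S (Set.Ioo (x₀ i) (x₁ i) ×ˢ Set.Ioo (y₀ i) (y₁ i))) ≤
    n * (ε + ∑ i ∈ F, c i * (2 * (1 / 2 ^ j) * (y₁ i - y₀ i) + 2 * (1 / 2 ^ k) * (x₁ i - x₀ i))) := by
  classical
  set box : ι → Set (ℝ × ℝ) := fun i => Set.Ioo (x₀ i) (x₁ i) ×ˢ Set.Ioo (y₀ i) (y₁ i) with hboxdef
  set A : ι → Finset (ℤ × ℤ) := fun i =>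
    innerIndices j (x₀ i) (x₁ i) ×ˢ innerIndices k (y₀ i) (y₁ i) with hA
  -- Only boxes with positive `c i` are known to lie in the bounded region; the others contribute
  -- minus a count, which is at most `0`.
  set F' := F.filter fun i => 0 < c i with hF'
  have hF'F : F' ⊆ F := Finset.filter_subset _ _
  have hsub : ∀ i, ∀ q ∈ A i, dyadicCell j k q ⊆ box i := by
    intro i q hq
    obtain ⟨h1, h2⟩ := Finset.mem_product.1 hq
    exact Set.prod_mono (Ico_subset_Ioo_of_mem_innerIndices h1)
      (Ico_subset_Ioo_of_mem_innerIndices h2)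
  have hAdisj : (F' : Set ι).PairwiseDisjoint A := by
    intro i hi i' hi' hne
    refine Finset.disjoint_left.2 fun q hq hq' => ?_
    exact Set.disjoint_left.1 (hdisj (hF'F hi) (hF'F hi') hne)
      (hsub i q hq (corner_mem_dyadicCell j k q)) (hsub i' q hq' (corner_mem_dyadicCell j k q))
  set T := F'.biUnion A with hT
  have hTbox : T ⊆ dyadicBox R j k := by
    intro q hq
    obtain ⟨i, hi, hqi⟩ := Finset.mem_biUnion.1 hq
    have h := hbox i (hF'F hi) (Finset.mem_filter.1 hi).2
      (hsub i q hqi (corner_mem_dyadicCell j k q))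
    have h1 : ∀ (l : ℕ) (a : ℤ), (a : ℝ) / 2 ^ l ∈ Set.Ico (-R : ℝ) R →
        a ∈ Finset.Ico (-(R * 2 ^ l) : ℤ) (R * 2 ^ l) := by
      intro l a ha
      rw [Set.mem_Ico, le_div_iff₀ (by positivity), div_lt_iff₀ (by positivity)] at ha
      rw [Finset.mem_Ico]
      constructor
      · have := ha.1; rw [neg_mul] at this; exact_mod_cast this
      · exact_mod_cast ha.2
    exact Finset.mem_product.2 ⟨h1 j _ h.1, h1 k _ h.2⟩
  -- The approximation is from inside: it can only reduce counts, and the mass it loses near the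
  -- sides of the boxes is bounded in `hmass`.
  have hcount : pointCount S (⋃ q ∈ T, dyadicCell j k q) ≤ ∑ i ∈ F', pointCount S (box i) := by
    refine pointCount_le_sum S fun p hp => ?_
    obtain ⟨q, hq, hpq⟩ := Set.mem_iUnion₂.1 hp
    obtain ⟨i, hi, hqi⟩ := Finset.mem_biUnion.1 hq
    exact Set.mem_iUnion₂.2 ⟨i, hi, hsub i q hqi hpq⟩
  have hmass : ∑ i ∈ F', (c i * ((x₁ i - x₀ i) * (y₁ i - y₀ i)) -
      c i * (2 * (1 / 2 ^ j) * (y₁ i - y₀ i) + 2 * (1 / 2 ^ k) * (x₁ i - x₀ i))) ≤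
      ∫ p in ⋃ q ∈ T, dyadicCell j k q, f p := by
    rw [integral_biUnion_finset _ (fun q _ => measurableSet_dyadicCell j k q)
      (fun q _ q' _ h => disjoint_dyadicCell h) (fun q _ => hf.integrableOn), hT,
      Finset.sum_biUnion hAdisj]
    refine Finset.sum_le_sum fun i hi => ?_
    have hiF := hF'F hi
    have h1 : ∀ q ∈ A i, c i * ((1 / 2 ^ j) * (1 / 2 ^ k)) ≤ ∫ p in dyadicCell j k q, f p := by
      intro q hq
      have hfin : volume (dyadicCell j k q) ≠ ⊤ := by
        intro h
        have := volume_real_dyadicCell j k q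
        rw [measureReal_def, h] at this
        have h0 : (0 : ℝ) < (1 / 2 ^ j) * (1 / 2 ^ k) := by positivity
        simp at this
      have := setIntegral_mono_on (μ := volume) (f := fun _ => c i) (g := f)
        (integrableOn_const hfin) hf.integrableOn (measurableSet_dyadicCell j k q)
        fun p hp => hcf i hiF p (hsub i q hq hp)
      rw [setIntegral_const, volume_real_dyadicCell, smul_eq_mul] at this
      linarith
    have h2 := Finset.card_nsmul_le_sum _ _ _ h1
    refine le_trans ?_ h2
    rw [hA, Finset.card_product, nsmul_eq_mul, ← mul_sub]
    push_cast
    have h3 := mul_sub_le_of_sub_le (t := 1 / 2 ^ j) (τ := 1 / 2 ^ k) (sub_nonneg.2 (hx i hiF))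
      (sub_nonneg.2 (hy i hiF)) (by positivity) (by positivity) (by positivity) (by positivity)
      (sub_le_card_innerIndices j (x₀ i) (x₁ i)) (sub_le_card_innerIndices k (y₀ i) (y₁ i))
    have h4 := mul_le_mul_of_nonneg_left h3 (hc i hiF)
    linarith
  have hD := hdef T hTbox
  rw [Finset.sum_sub_distrib] at hmass
  have hL : ∑ i ∈ F, (n * (c i * ((x₁ i - x₀ i) * (y₁ i - y₀ i))) - pointCount S (box i)) ≤
      ∑ i ∈ F', (n * (c i * ((x₁ i - x₀ i) * (y₁ i - y₀ i))) - pointCount S (box i)) := by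
    rw [hF', Finset.sum_filter]
    refine Finset.sum_le_sum fun i hi => ?_
    split_ifs with h
    · exact le_rfl
    · rw [le_antisymm (not_lt.1 h) (hc i hi)]
      have := pointCount_nonneg S (box i)
      linarith
  have hR : ∑ i ∈ F', c i * (2 * (1 / 2 ^ j) * (y₁ i - y₀ i) + 2 * (1 / 2 ^ k) * (x₁ i - x₀ i)) ≤
      ∑ i ∈ F, c i * (2 * (1 / 2 ^ j) * (y₁ i - y₀ i) + 2 * (1 / 2 ^ k) * (x₁ i - x₀ i)) := by
    refine Finset.sum_le_sum_of_subset_of_nonneg hF'F fun i hi _ => ?_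
    have h1 := sub_nonneg.2 (hx i hi)
    have h2 := sub_nonneg.2 (hy i hi)
    have h3 := hc i hi
    positivity
  rw [Finset.sum_sub_distrib, ← Finset.mul_sum] at hL
  rw [Finset.sum_sub_distrib, ← Finset.mul_sum] at *
  nlinarith [mul_le_mul_of_nonneg_left hmass hn, mul_le_mul_of_nonneg_left hR hn]

theorem sum_length_le {ι : Type*} {T : Finset ι} {lo hi : ι → ℝ} {a b : ℝ} (hab : a ≤ b)
    (h : ∀ j ∈ T, a ≤ lo j ∧ lo j ≤ hi j ∧ hi j ≤ b)
    (hd : (T : Set ι).PairwiseDisjoint fun j => Set.Ioo (lo j) (hi j)) :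
    ∑ j ∈ T, (hi j - lo j) ≤ b - a := by
  have h1 : ∑ j ∈ T, (hi j - lo j) = volume.real (⋃ j ∈ T, Set.Ioo (lo j) (hi j)) := by
    rw [measureReal_biUnion_finset hd (fun _ _ => measurableSet_Ioo) (fun _ _ => by simp)]
    refine Finset.sum_congr rfl fun j hj => ?_
    rw [Real.volume_real_Ioo_of_le (h j hj).2.1]
  rw [h1, ← Real.volume_real_Icc_of_le hab]
  refine measureReal_mono (Set.iUnion₂_subset fun j hj x hx => ?_) (by simp)
  exact ⟨(h j hj).1.trans hx.1.le, hx.2.le.trans (h j hj).2.2⟩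

theorem setIntegral_min_mem_Icc (s : Multiset ℝ) {a b : ℝ} (hab : a < b) :
    ∫ x in Set.Ioo a b, min (1 / (b - a)) (spacingDensity s x) ∈ Set.Icc (0 : ℝ) 1 := by
  have hw : 0 < b - a := by linarith
  refine ⟨setIntegral_nonneg measurableSet_Ioo fun x _ =>
    le_min (by positivity) (spacingDensity_nonneg s x), ?_⟩
  have hb : IntegrableOn (fun _ : ℝ => 1 / (b - a)) (Set.Ioo a b) := integrableOn_const (by simp)
  calc _ ≤ ∫ x in Set.Ioo a b, 1 / (b - a) := by
        refine setIntegral_mono_on (hb.mono' ?_ ?_) hb measurableSet_Ioo fun x _ => min_le_left _ _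
        · exact (measurable_const.min (measurable_spacingDensity s)).aestronglyMeasurable
        · refine ae_of_all _ fun x => ?_
          rw [Real.norm_of_nonneg (le_min (by positivity) (spacingDensity_nonneg s x))]
          exact min_le_left _ _
    _ = 1 := by
        rw [setIntegral_const, Real.volume_real_Ioo_of_le hab.le, smul_eq_mul]
        field_simp

/-- If the samples `s i` from the sides `[α i, α i + w]` of a family of `w × v` cells have small
total deficit in families of disjoint intervals, then their spacing densities miss little mass. -/
theorem sum_missing_mass_le {κ : Type*} {F : Finset κ} {s : κ → Multiset ℝ} {α c : κ → ℝ}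
    {w v n ε t τ : ℝ} (hw : 0 < w) (hv : 0 < v) (hn : 0 ≤ n) (ht : 0 ≤ t) (hτ : 0 ≤ τ)
    (hc : ∀ i ∈ F, 0 ≤ c i) (hmem : ∀ i ∈ F, ∀ x ∈ s i, x ∈ Set.Icc (α i) (α i + w))
    (H : ∀ (T : Finset (Σ _ : κ, ℕ)) (lo hi : (Σ _ : κ, ℕ) → ℝ), (∀ p ∈ T, p.1 ∈ F) →
      (∀ p ∈ T, α p.1 ≤ lo p ∧ lo p ≤ hi p ∧ hi p ≤ α p.1 + w) →
      (∀ p ∈ T, ∀ q ∈ T, p ≠ q → p.1 = q.1 →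
        Disjoint (Set.Ioo (lo p) (hi p)) (Set.Ioo (lo q) (hi q))) →
      ∑ p ∈ T, (n * (c p.1 * ((hi p - lo p) * v)) - pointCount (s p.1) (Set.Ioo (lo p) (hi p))) ≤
        n * (ε + ∑ p ∈ T, c p.1 * (2 * t * v + 2 * τ * (hi p - lo p)))) :
    ∑ i ∈ F, (s i).card *
      (1 - ∫ x in Set.Ioo (α i) (α i + w), min (1 / w) (spacingDensity (s i) x)) ≤
    ∑ i ∈ F, (4 * spacingParam (s i).card : ℝ) +
      ∑ i ∈ F, max ((s i).card - n * (c i * (w * v))) 0 +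
      n * (ε + ∑ i ∈ F, c i * (2 * t * v * Real.sqrt (s i).card + 2 * τ * w)) := by
  classical
  have key : ∀ i, ∃ (T : Finset ℕ) (lo hi : ℕ → ℝ), i ∈ F → ((T.card : ℝ) ≤ Real.sqrt (s i).card ∧
      (∀ j ∈ T, α i ≤ lo j ∧ lo j ≤ hi j ∧ hi j ≤ α i + w) ∧
      (T : Set ℕ).PairwiseDisjoint (fun j => Set.Ioo (lo j) (hi j)) ∧
      (s i).card * (1 - ∫ x in Set.Ioo (α i) (α i + w), min (1 / w) (spacingDensity (s i) x)) ≤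
        4 * spacingParam (s i).card + (s i).card * (∑ j ∈ T, (hi j - lo j)) / w -
          ∑ j ∈ T, pointCount (s i) (Set.Ioo (lo j) (hi j))) := by
    intro i
    by_cases hi : i ∈ F
    · rcases Nat.eq_zero_or_pos (s i).card with h0 | h0
      · exact ⟨∅, fun _ => 0, fun _ => 0, fun _ => by simp [h0]⟩
      · obtain ⟨T, lo, hi', h⟩ := exists_sparse_intervals h0 (hmem i hi)
          (show α i < α i + w by linarith)
        rw [add_sub_cancel_left] at h
        exact ⟨T, lo, hi', fun _ => h⟩
    · exact ⟨∅, fun _ => 0, fun _ => 0, fun h => absurd h hi⟩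
  choose T lo hi hT using key
  have hH := H (F.sigma T) (fun p => lo p.1 p.2) (fun p => hi p.1 p.2)
    (fun p hp => (Finset.mem_sigma.1 hp).1)
    (fun p hp => (hT p.1 (Finset.mem_sigma.1 hp).1).2.1 p.2 (Finset.mem_sigma.1 hp).2)
    (by
      rintro ⟨i, j⟩ hp ⟨i', j'⟩ hq hne heq
      obtain rfl : i = i' := heq
      have hp' := Finset.mem_sigma.1 hp
      have hq' := Finset.mem_sigma.1 hq
      exact (hT i hp'.1).2.2.1 hp'.2 hq'.2 fun h => hne (Sigma.ext rfl (heq_of_eq h)))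
  rw [Finset.sum_sigma, Finset.sum_sigma] at hH
  have hcell : ∀ i ∈ F, (s i).card *
      (1 - ∫ x in Set.Ioo (α i) (α i + w), min (1 / w) (spacingDensity (s i) x)) ≤
      (4 * spacingParam (s i).card : ℝ) + max ((s i).card - n * (c i * (w * v))) 0 +
      ∑ j ∈ T i, (n * (c i * ((hi i j - lo i j) * v)) -
        pointCount (s i) (Set.Ioo (lo i j) (hi i j))) := by
    intro i hiF
    obtain ⟨h1, h2, h3, h4⟩ := hT i hiF
    have hlen := sum_length_le (by linarith) h2 h3
    rw [add_sub_cancel_left] at hlen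
    have hlen0 : 0 ≤ ∑ j ∈ T i, (hi i j - lo i j) :=
      Finset.sum_nonneg fun j hj => by linarith [(h2 j hj).2.1]
    rw [Finset.sum_sub_distrib, ← Finset.mul_sum, ← Finset.mul_sum, ← Finset.sum_mul]
    set X := ∑ j ∈ T i, (hi i j - lo i j)
    -- The selected intervals have total length `X ≤ w`. Passing from the intensity `N / w` of the
    -- sample to the intensity `n * c * v` therefore costs at most the excess of the whole cell.
    have h5 : ((s i).card - n * (c i * (w * v))) * (X / w) ≤
        max ((s i).card - n * (c i * (w * v))) 0 :=
      (mul_le_mul_of_nonneg_right (le_max_left _ 0) (by positivity)).trans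
        (mul_le_of_le_one_right (le_max_right _ _) ((div_le_one hw).2 hlen))
    have h6 : ((s i).card - n * (c i * (w * v))) * (X / w) =
        (s i).card * X / w - n * (c i * (X * v)) := by field_simp
    linarith
  have hloss : ∀ i ∈ F, ∑ j ∈ T i, c i * (2 * t * v + 2 * τ * (hi i j - lo i j)) ≤
      c i * (2 * t * v * Real.sqrt (s i).card + 2 * τ * w) := by
    intro i hiF
    obtain ⟨h1, h2, h3, -⟩ := hT i hiF
    have hlen := sum_length_le (by linarith) h2 h3
    rw [add_sub_cancel_left] at hlen
    rw [← Finset.mul_sum, Finset.sum_add_distrib, ← Finset.mul_sum (T i) _ (2 * τ),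
      Finset.sum_const, nsmul_eq_mul, mul_comm ((T i).card : ℝ)]
    exact mul_le_mul_of_nonneg_left (add_le_add
      (mul_le_mul_of_nonneg_left h1 (by positivity))
      (mul_le_mul_of_nonneg_left hlen (by positivity))) (hc i hiF)
  have h1 := Finset.sum_le_sum hcell
  have h2 := mul_le_mul_of_nonneg_left (add_le_add_right (Finset.sum_le_sum hloss) ε) hn
  rw [Finset.sum_add_distrib, Finset.sum_add_distrib] at h1
  linarith

/-- A product of truncated marginals is at most the product of the truncation levels and at most the
product of the marginals. This bounds the integrand from below by a product function, which
integrates by Fubini. -/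
theorem mul_le_setIntegral_min {gX gY : Multiset ℝ} {x₀ x₁ y₀ y₁ c q : ℝ} (hx : x₀ < x₁)
    (hy : y₀ < y₁) (hc : 0 ≤ c) (hq : 0 ≤ q) :
    min (c * ((x₁ - x₀) * (y₁ - y₀))) q *
      ((∫ x in Set.Ioo x₀ x₁, min (1 / (x₁ - x₀)) (spacingDensity gX x)) *
        ∫ y in Set.Ioo y₀ y₁, min (1 / (y₁ - y₀)) (spacingDensity gY y)) ≤
    ∫ p in Set.Ioo x₀ x₁ ×ˢ Set.Ioo y₀ y₁,
      min c (q * (spacingDensity gX p.1 * spacingDensity gY p.2)) := by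
  have hw : 0 < x₁ - x₀ := by linarith
  have hv : 0 < y₁ - y₀ := by linarith
  rw [Measure.volume_eq_prod, ← setIntegral_prod_mul, ← integral_const_mul]
  have hmX : Measurable fun p : ℝ × ℝ => spacingDensity gX p.1 :=
    (measurable_spacingDensity gX).comp measurable_fst
  have hmY : Measurable fun p : ℝ × ℝ => spacingDensity gY p.2 :=
    (measurable_spacingDensity gY).comp measurable_snd
  have hle : ∀ p : ℝ × ℝ, min (c * ((x₁ - x₀) * (y₁ - y₀))) q *
      (min (1 / (x₁ - x₀)) (spacingDensity gX p.1) * min (1 / (y₁ - y₀)) (spacingDensity gY p.2)) ≤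
      min c (q * (spacingDensity gX p.1 * spacingDensity gY p.2)) := by
    intro p
    have h1 := spacingDensity_nonneg gX p.1
    have h2 := spacingDensity_nonneg gY p.2
    refine le_min ?_ ?_
    · calc _ ≤ c * ((x₁ - x₀) * (y₁ - y₀)) * (1 / (x₁ - x₀) * (1 / (y₁ - y₀))) := by
            gcongr <;> exact min_le_left _ _
        _ = c := by field_simp
    · gcongr <;> exact min_le_right _ _
  have h0 : ∀ p : ℝ × ℝ, 0 ≤ min (c * ((x₁ - x₀) * (y₁ - y₀))) q *
      (min (1 / (x₁ - x₀)) (spacingDensity gX p.1) *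
        min (1 / (y₁ - y₀)) (spacingDensity gY p.2)) := by
    intro p
    have h1 := spacingDensity_nonneg gX p.1
    have h2 := spacingDensity_nonneg gY p.2
    positivity
  have hfin : (volume.prod volume) (Set.Ioo x₀ x₁ ×ˢ Set.Ioo y₀ y₁) ≠ ⊤ := by
    rw [Measure.prod_prod]
    exact ENNReal.mul_ne_top (by simp) (by simp)
  have hcint : IntegrableOn (fun _ : ℝ × ℝ => c) (Set.Ioo x₀ x₁ ×ˢ Set.Ioo y₀ y₁)
    (volume.prod volume) := integrableOn_const hfin
  refine setIntegral_mono_on (hcint.mono' ?_ ?_) (hcint.mono' ?_ ?_)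
    (measurableSet_Ioo.prod measurableSet_Ioo) fun p _ => hle p
  · exact (measurable_const.mul ((measurable_const.min hmX).mul
      (measurable_const.min hmY))).aestronglyMeasurable
  · refine ae_of_all _ fun p => ?_
    rw [Real.norm_of_nonneg (h0 p)]
    exact (hle p).trans (min_le_left _ _)
  · exact (measurable_const.min (measurable_const.mul (hmX.mul hmY))).aestronglyMeasurable
  · refine ae_of_all _ fun p => ?_
    rw [Real.norm_of_nonneg ((h0 p).trans (hle p))]
    exact min_le_left _ _

/-! ### Geometry of the cells and counting in them. -/

/-- The left end point of the `a`-th segment of the range of the sample `s`. -/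
noncomputable def segmentLeft (s : Multiset ℝ) (ℓ a : ℕ) : ℝ :=
  orderStat s 1 + a * segmentWidth s ℓ

theorem segmentWidth_nonneg (s : Multiset ℝ) (ℓ : ℕ) : 0 ≤ segmentWidth s ℓ := by
  have h : orderStat s 1 ≤ orderStat s s.card := by
    rcases Nat.eq_zero_or_pos s.card with h | h
    · rw [orderStat_of_card_le s (i := 1) (by omega)]
    · exact orderStat_mono s (by omega)
  exact div_nonneg (by linarith) (by positivity)

theorem segmentLeft_add_width (s : Multiset ℝ) (ℓ a : ℕ) :
    segmentLeft s ℓ a + segmentWidth s ℓ = segmentLeft s ℓ (a + 1) := by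
  simp only [segmentLeft]; push_cast; ring

theorem segmentLeft_self (s : Multiset ℝ) {ℓ : ℕ} (hℓ : 0 < ℓ) :
    segmentLeft s ℓ ℓ = orderStat s s.card := by
  have : (0 : ℝ) < ℓ := by exact_mod_cast hℓ
  rw [segmentLeft, segmentWidth]; field_simp; ring

theorem segmentLeft_mono (s : Multiset ℝ) (ℓ : ℕ) : Monotone (segmentLeft s ℓ) := by
  intro a b hab
  have := segmentWidth_nonneg s ℓ
  unfold segmentLeft
  gcongr

theorem rangeSegment_eq (s : Multiset ℝ) {ℓ a : ℕ} (ha : a < ℓ) :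
    rangeSegment s ℓ a = if a + 1 = ℓ then Set.Icc (segmentLeft s ℓ a) (segmentLeft s ℓ (a + 1))
      else Set.Ico (segmentLeft s ℓ a) (segmentLeft s ℓ (a + 1)) := by
  unfold rangeSegment
  split_ifs with h
  · subst h
    rw [segmentLeft_self s (by omega)]
    rfl
  · simp [segmentLeft]

theorem rangeSegment_subset (s : Multiset ℝ) {ℓ a : ℕ} (ha : a < ℓ) :
    rangeSegment s ℓ a ⊆ Set.Icc (segmentLeft s ℓ a) (segmentLeft s ℓ (a + 1)) := by
  rw [rangeSegment_eq s ha]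
  split_ifs
  · exact le_rfl
  · exact Set.Ico_subset_Icc_self

theorem Ico_subset_rangeSegment (s : Multiset ℝ) {ℓ a : ℕ} (ha : a < ℓ) :
    Set.Ico (segmentLeft s ℓ a) (segmentLeft s ℓ (a + 1)) ⊆ rangeSegment s ℓ a := by
  rw [rangeSegment_eq s ha]
  split_ifs
  · exact Set.Ico_subset_Icc_self
  · exact le_rfl

theorem disjoint_rangeSegment_of_lt (s : Multiset ℝ) {ℓ a b : ℕ} (hb : b < ℓ) (hab : a < b) :
    Disjoint (rangeSegment s ℓ a) (rangeSegment s ℓ b) := by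
  refine Set.disjoint_left.2 fun x hx hx' => ?_
  rw [rangeSegment_eq s (hab.trans hb), if_neg (by omega)] at hx
  exact absurd (hx.2.trans_le (segmentLeft_mono s ℓ hab)) (not_lt.2 (rangeSegment_subset s hb hx').1)

theorem disjoint_rangeSegment (s : Multiset ℝ) {ℓ a b : ℕ} (ha : a < ℓ) (hb : b < ℓ) (hab : a ≠ b) :
    Disjoint (rangeSegment s ℓ a) (rangeSegment s ℓ b) := by
  rcases lt_or_gt_of_ne hab with h | h
  · exact disjoint_rangeSegment_of_lt s hb h
  · exact (disjoint_rangeSegment_of_lt s ha h).symm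

theorem exists_mem_segment {s : Multiset ℝ} {ℓ : ℕ} (hw : 0 < segmentWidth s ℓ) {x : ℝ}
    (hx : x ∈ Set.Ico (orderStat s 1) (orderStat s s.card)) :
    ∃ a < ℓ, x ∈ Set.Ico (segmentLeft s ℓ a) (segmentLeft s ℓ (a + 1)) := by
  have hℓ : 0 < ℓ := by
    rcases Nat.eq_zero_or_pos ℓ with h | h
    · simp [h, segmentWidth] at hw
    · exact h
  have h0 : 0 ≤ (x - orderStat s 1) / segmentWidth s ℓ := div_nonneg (by linarith [hx.1]) hw.le
  have h1 := Nat.floor_le h0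
  have h2 := Nat.lt_floor_add_one ((x - orderStat s 1) / segmentWidth s ℓ)
  rw [le_div_iff₀ hw] at h1
  rw [div_lt_iff₀ hw] at h2
  set a := ⌊(x - orderStat s 1) / segmentWidth s ℓ⌋₊
  have h3 : segmentLeft s ℓ a ≤ x := by unfold segmentLeft; linarith
  refine ⟨a, ?_, h3, by unfold segmentLeft; push_cast; linarith⟩
  by_contra! h
  have := segmentLeft_mono s ℓ h
  rw [segmentLeft_self s hℓ] at this
  linarith [hx.2]

theorem pointCount_cons {α : Type*} (x : α) (S : Multiset α) (B : Set α) :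
    pointCount (x ::ₘ S) B = B.indicator (fun _ => (1 : ℝ)) x + pointCount S B := by
  simp [pointCount]

theorem pointCount_univ {α : Type*} (S : Multiset α) : pointCount S Set.univ = S.card := by
  simp [pointCount]

theorem pointCount_le_pointCount_map_filter {α β : Type*} (S : Multiset α) (p : α → Prop)
    [DecidablePred p] (g : α → β) {D : Set α} {B : Set β} (h : ∀ x ∈ D, p x ∧ g x ∈ B) :
    pointCount S D ≤ pointCount ((S.filter p).map g) B := by
  induction S using Multiset.induction with
  | empty => simp [pointCount]
  | cons x S ih =>
    rw [pointCount_cons]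
    by_cases hp : p x
    · rw [Multiset.filter_cons_of_pos _ hp, Multiset.map_cons, pointCount_cons]
      refine add_le_add ?_ ih
      by_cases hx : x ∈ D
      · simp [hx, (h x hx).2]
      · rw [Set.indicator_of_notMem hx]
        exact Set.indicator_nonneg (fun _ _ => zero_le_one) _
    · rw [Multiset.filter_cons_of_neg _ hp, Set.indicator_of_notMem fun hx => hp (h x hx).1,
        zero_add]
      exact ih

theorem sum_card_filter_le {α ι : Type*} (S : Multiset α) (F : Finset ι) (p : ι → α → Prop)
    [∀ i, DecidablePred (p i)] (h : ∀ x, ∀ i ∈ F, ∀ j ∈ F, p i x → p j x → i = j) :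
    ∑ i ∈ F, (S.filter (p i)).card ≤ S.card := by
  induction S using Multiset.induction with
  | empty => simp
  | cons x S ih =>
    simp only [Multiset.filter_cons, Multiset.card_add, Finset.sum_add_distrib, Multiset.card_cons]
    have h1 : ∑ i ∈ F, (if p i x then ({x} : Multiset α) else 0).card ≤ 1 := by
      have : ∀ i, (if p i x then ({x} : Multiset α) else 0).card = if p i x then 1 else 0 := by
        intro i; split_ifs <;> simp
      simp only [this, Finset.sum_boole, Nat.cast_id]
      refine Finset.card_le_one.2 fun i hi j hj => ?_
      rw [Finset.mem_filter] at hi hj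
      exact h x i hi.1 j hj.1 hi.2 hj.2
    omega

/-- The `ℓ ^ 2` indices of the cells. -/
def cellIndices (ℓ : ℕ) : Finset (ℕ × ℕ) := Finset.range ℓ ×ˢ Finset.range ℓ

theorem mem_cellIndices {ℓ : ℕ} {i : ℕ × ℕ} : i ∈ cellIndices ℓ ↔ i.1 < ℓ ∧ i.2 < ℓ := by
  simp [cellIndices]

/-- The cell with index `i`, as a half-open rectangle. -/
def cellRect (S : Multiset (ℝ × ℝ)) (ℓ : ℕ) (i : ℕ × ℕ) : Set (ℝ × ℝ) :=
  Set.Ico (segmentLeft (S.map Prod.fst) ℓ i.1) (segmentLeft (S.map Prod.fst) ℓ (i.1 + 1)) ×ˢ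
    Set.Ico (segmentLeft (S.map Prod.snd) ℓ i.2) (segmentLeft (S.map Prod.snd) ℓ (i.2 + 1))

theorem eq_of_mem_rangeSegment {S : Multiset (ℝ × ℝ)} {ℓ : ℕ} {i j : ℕ × ℕ} (hi : i ∈ cellIndices ℓ)
    (hj : j ∈ cellIndices ℓ) {p : ℝ × ℝ}
    (h1 : p.1 ∈ rangeSegment (S.map Prod.fst) ℓ i.1 ∧ p.2 ∈ rangeSegment (S.map Prod.snd) ℓ i.2)
    (h2 : p.1 ∈ rangeSegment (S.map Prod.fst) ℓ j.1 ∧ p.2 ∈ rangeSegment (S.map Prod.snd) ℓ j.2) :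
    i = j := by
  rw [mem_cellIndices] at hi hj
  by_contra hne
  rcases not_and_or.1 (fun h => hne (Prod.ext h.1 h.2) : ¬(i.1 = j.1 ∧ i.2 = j.2)) with h | h
  · exact Set.disjoint_left.1 (disjoint_rangeSegment _ hi.1 hj.1 h) h1.1 h2.1
  · exact Set.disjoint_left.1 (disjoint_rangeSegment _ hi.2 hj.2 h) h1.2 h2.2

theorem cellRect_mem_rangeSegment {S : Multiset (ℝ × ℝ)} {ℓ : ℕ} {i : ℕ × ℕ}
    (hi : i ∈ cellIndices ℓ) {p : ℝ × ℝ} (hp : p ∈ cellRect S ℓ i) :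
    p.1 ∈ rangeSegment (S.map Prod.fst) ℓ i.1 ∧ p.2 ∈ rangeSegment (S.map Prod.snd) ℓ i.2 :=
  ⟨Ico_subset_rangeSegment _ (mem_cellIndices.1 hi).1 hp.1,
    Ico_subset_rangeSegment _ (mem_cellIndices.1 hi).2 hp.2⟩

theorem pairwiseDisjoint_cellRect (S : Multiset (ℝ × ℝ)) (ℓ : ℕ) :
    (cellIndices ℓ : Set (ℕ × ℕ)).PairwiseDisjoint (cellRect S ℓ) := by
  intro i hi j hj hne
  refine Set.disjoint_left.2 fun p hp hp' => hne ?_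
  exact eq_of_mem_rangeSegment hi hj (cellRect_mem_rangeSegment hi hp)
    (cellRect_mem_rangeSegment hj hp')

theorem sum_card_cellSample_le (S : Multiset (ℝ × ℝ)) (ℓ : ℕ) :
    ∑ i ∈ cellIndices ℓ, (cellSample S ℓ i.1 i.2).card ≤ S.card := by
  classical
  unfold cellSample
  exact sum_card_filter_le S (cellIndices ℓ) _ fun x i hi j hj h1 h2 =>
    eq_of_mem_rangeSegment hi hj h1 h2

theorem mem_of_mem_cellSample {S : Multiset (ℝ × ℝ)} {ℓ : ℕ} {i : ℕ × ℕ} {p : ℝ × ℝ}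
    (hp : p ∈ cellSample S ℓ i.1 i.2) : p.1 ∈ rangeSegment (S.map Prod.fst) ℓ i.1 ∧
      p.2 ∈ rangeSegment (S.map Prod.snd) ℓ i.2 := by
  classical
  unfold cellSample at hp
  exact (Multiset.mem_filter.1 hp).2

theorem pointCount_le_cellSample {β : Type*} {S : Multiset (ℝ × ℝ)} {ℓ : ℕ} {i : ℕ × ℕ}
    (hi : i ∈ cellIndices ℓ) (g : ℝ × ℝ → β) {D : Set (ℝ × ℝ)} {B : Set β}
    (hD : D ⊆ cellRect S ℓ i) (hB : ∀ x ∈ D, g x ∈ B) :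
    pointCount S D ≤ pointCount ((cellSample S ℓ i.1 i.2).map g) B := by
  classical
  unfold cellSample
  exact pointCount_le_pointCount_map_filter S _ g fun x hx =>
    ⟨cellRect_mem_rangeSegment hi (hD hx), hB x hx⟩

/-! ### Upper bound for the mass of the partitioned estimator. -/

theorem partitionedDensity_eq (S : Multiset (ℝ × ℝ)) (ℓ : ℕ) (p : ℝ × ℝ) :
    partitionedDensity S ℓ p = ∑ i ∈ cellIndices ℓ, ((cellSample S ℓ i.1 i.2).card : ℝ) / S.card *
      (spacingDensity ((cellSample S ℓ i.1 i.2).map Prod.fst) p.1 *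
        spacingDensity ((cellSample S ℓ i.1 i.2).map Prod.snd) p.2) := by
  rw [partitionedDensity, cellIndices, Finset.sum_product]

theorem integrable_partitionedDensity (S : Multiset (ℝ × ℝ)) (ℓ : ℕ) :
    Integrable (partitionedDensity S ℓ) := by
  have : partitionedDensity S ℓ = fun p => ∑ i ∈ cellIndices ℓ,
      ((cellSample S ℓ i.1 i.2).card : ℝ) / S.card *
      (spacingDensity ((cellSample S ℓ i.1 i.2).map Prod.fst) p.1 *
        spacingDensity ((cellSample S ℓ i.1 i.2).map Prod.snd) p.2) :=
    funext (partitionedDensity_eq S ℓ)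
  rw [this]
  exact integrable_finsetSum _ fun i _ =>
    ((integrable_spacingDensity _).mul_prod (integrable_spacingDensity _)).const_mul _

theorem partitionedDensity_nonneg (S : Multiset (ℝ × ℝ)) (ℓ : ℕ) (p : ℝ × ℝ) :
    0 ≤ partitionedDensity S ℓ p := by
  rw [partitionedDensity_eq]
  refine Finset.sum_nonneg fun i _ => ?_
  have := spacingDensity_nonneg ((cellSample S ℓ i.1 i.2).map Prod.fst) p.1
  have := spacingDensity_nonneg ((cellSample S ℓ i.1 i.2).map Prod.snd) p.2
  positivity

/-- Cauchy–Schwarz for `√N` over `ℓ ^ 2` cells whose counts add up to at most the sample size. -/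
theorem sum_spacingParam_le (S : Multiset (ℝ × ℝ)) (ℓ : ℕ) :
    ∑ i ∈ cellIndices ℓ, (spacingParam (cellSample S ℓ i.1 i.2).card : ℝ) ≤
      ℓ * Real.sqrt S.card + ℓ ^ 2 := by
  have hcs := Real.sum_sqrt_mul_sqrt_le (cellIndices ℓ) (f := fun _ => 1)
    (g := fun i => ((cellSample S ℓ i.1 i.2).card : ℝ)) (fun _ => zero_le_one)
    (fun _ => by positivity)
  have hc : ((cellIndices ℓ).card : ℝ) = ℓ ^ 2 := by
    simp [cellIndices, Finset.card_product, sq]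
  simp only [Real.sqrt_one, one_mul, Finset.sum_const, nsmul_eq_mul, mul_one, hc] at hcs
  rw [Real.sqrt_sq (by positivity)] at hcs
  have hN : (∑ i ∈ cellIndices ℓ, ((cellSample S ℓ i.1 i.2).card : ℝ)) ≤ S.card := by
    exact_mod_cast sum_card_cellSample_le S ℓ
  calc _ ≤ ∑ i ∈ cellIndices ℓ, (Real.sqrt (cellSample S ℓ i.1 i.2).card + 1 / 2) :=
        Finset.sum_le_sum fun i _ => spacingParam_le _
    _ ≤ ℓ * Real.sqrt S.card + ℓ ^ 2 := by
        rw [Finset.sum_add_distrib, Finset.sum_const, nsmul_eq_mul, hc]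
        have := Real.sqrt_le_sqrt hN
        have h2 : (ℓ : ℝ) * Real.sqrt (∑ i ∈ cellIndices ℓ, ((cellSample S ℓ i.1 i.2).card : ℝ)) ≤
          ℓ * Real.sqrt S.card := by gcongr
        have : (0 : ℝ) ≤ (ℓ : ℝ) ^ 2 := by positivity
        linarith

/-- Each cell contributes at most `N * (1 + 4 * m / N) ^ 2 / n`. The linear term gives `8 * m`, and
`m ^ 2 ≤ 3 * N` turns the quadratic one into the `48` per cell. -/
theorem integral_partitionedDensity_le {S : Multiset (ℝ × ℝ)} (hS : 0 < S.card) (ℓ : ℕ) :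
    ∫ p, partitionedDensity S ℓ p ≤ 1 + (8 * (ℓ * Real.sqrt S.card + ℓ ^ 2) + 48 * ℓ ^ 2) / S.card := by
  have hS' : (0 : ℝ) < S.card := by exact_mod_cast hS
  simp only [partitionedDensity_eq]
  rw [Measure.volume_eq_prod, integral_finsetSum _ fun i _ =>
    ((integrable_spacingDensity _).mul_prod (integrable_spacingDensity _)).const_mul _]
  have hN : (∑ i ∈ cellIndices ℓ, ((cellSample S ℓ i.1 i.2).card : ℝ)) ≤ S.card := by
    exact_mod_cast sum_card_cellSample_le S ℓ
  have hc : ((cellIndices ℓ).card : ℝ) = ℓ ^ 2 := by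
    simp [cellIndices, Finset.card_product, sq]
  have hm := sum_spacingParam_le S ℓ
  have hterm : ∀ i ∈ cellIndices ℓ, ∫ p : ℝ × ℝ, ((cellSample S ℓ i.1 i.2).card : ℝ) / S.card *
      (spacingDensity ((cellSample S ℓ i.1 i.2).map Prod.fst) p.1 *
        spacingDensity ((cellSample S ℓ i.1 i.2).map Prod.snd) p.2) ≤
      ((cellSample S ℓ i.1 i.2).card + 8 * spacingParam (cellSample S ℓ i.1 i.2).card + 48) /
        S.card := by
    intro i _
    rw [Measure.volume_eq_prod, integral_const_mul, integral_prod_mul, div_mul_eq_mul_div]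
    refine div_le_div_of_nonneg_right ?_ hS'.le
    set s := cellSample S ℓ i.1 i.2
    rcases Nat.eq_zero_or_pos s.card with h0 | h0
    · rw [h0]; simp; positivity
    have h0' : (1 : ℝ) ≤ s.card := by exact_mod_cast h0
    have hX := integral_spacingDensity_le (s := s.map Prod.fst) (by simpa using h0)
    have hY := integral_spacingDensity_le (s := s.map Prod.snd) (by simpa using h0)
    rw [Multiset.card_map] at hX hY
    have hY0 : 0 ≤ ∫ y, spacingDensity (s.map Prod.snd) y :=
      integral_nonneg (spacingDensity_nonneg _)
    have hm2 : (spacingParam s.card : ℝ) ^ 2 ≤ 3 * s.card := by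
      have h1 := spacingParam_le s.card
      have h2 := Real.sq_sqrt (show (0 : ℝ) ≤ s.card by positivity)
      have h3 : (1 : ℝ) ≤ Real.sqrt s.card := Real.one_le_sqrt.2 h0'
      have h4 : (spacingParam s.card : ℝ) ^ 2 ≤ (Real.sqrt s.card + 1 / 2) ^ 2 := by gcongr
      nlinarith
    calc (s.card : ℝ) * ((∫ x, spacingDensity (s.map Prod.fst) x) *
          ∫ y, spacingDensity (s.map Prod.snd) y) ≤
          s.card * ((1 + 4 * spacingParam s.card / s.card) *
            (1 + 4 * spacingParam s.card / s.card)) := by gcongr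
      _ = s.card + 8 * spacingParam s.card + 16 * (spacingParam s.card ^ 2 / s.card) := by
          field_simp; ring
      _ ≤ s.card + 8 * spacingParam s.card + 48 := by
          have : (spacingParam s.card : ℝ) ^ 2 / s.card ≤ 3 := by
            rw [div_le_iff₀ (by positivity)]; exact hm2
          linarith
  refine (Finset.sum_le_sum hterm).trans ?_
  rw [← Finset.sum_div, Finset.sum_add_distrib, Finset.sum_add_distrib, ← Finset.mul_sum,
    Finset.sum_const, nsmul_eq_mul, hc]
  rw [show (1 : ℝ) + (8 * (ℓ * Real.sqrt S.card + ℓ ^ 2) + 48 * ℓ ^ 2) / S.card =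
    (S.card + 8 * (ℓ * Real.sqrt S.card + ℓ ^ 2) + 48 * ℓ ^ 2) / S.card by field_simp; ring]
  refine div_le_div_of_nonneg_right ?_ hS'.le
  linarith

/-! ### Lower bound for the overlap with the density. -/

/-- Cauchy–Schwarz, where `c ≤ C` and total mass at most `1` give `∑ (c * A) ^ 2 ≤ C * A`. It
controls the boundary loss when cell `i` is cut into up to `√(N i)` strips. -/
theorem sum_mul_sqrt_le {κ : Type*} {F : Finset κ} {c N : κ → ℝ} {A C n : ℝ} (hA : 0 ≤ A)
    (hC : 0 ≤ C) (hc0 : ∀ i ∈ F, 0 ≤ c i) (hcC : ∀ i ∈ F, c i ≤ C) (hN : ∀ i, 0 ≤ N i)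
    (hM : ∑ i ∈ F, c i * A ≤ 1) (hn : ∑ i ∈ F, N i ≤ n) :
    ∑ i ∈ F, c i * A * Real.sqrt (N i) ≤ Real.sqrt C * Real.sqrt (n * A) := by
  have hcs := Real.sum_sqrt_mul_sqrt_le F (f := fun i => (c i * A) ^ 2) (g := N)
    (fun i => by positivity) hN
  have h1 : ∑ i ∈ F, c i * A * Real.sqrt (N i) =
      ∑ i ∈ F, Real.sqrt ((c i * A) ^ 2) * Real.sqrt (N i) :=
    Finset.sum_congr rfl fun i hi => by rw [Real.sqrt_sq (mul_nonneg (hc0 i hi) hA)]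
  have h2 : ∑ i ∈ F, (c i * A) ^ 2 ≤ C * A := by
    calc _ ≤ ∑ i ∈ F, C * A * (c i * A) := Finset.sum_le_sum fun i hi => by
          rw [sq]
          have := hc0 i hi
          have := hcC i hi
          gcongr
      _ ≤ C * A := by
          rw [← Finset.mul_sum]
          exact mul_le_of_le_one_right (by positivity) hM
  rw [h1, ← Real.sqrt_mul hC]
  refine hcs.trans ?_
  rw [← Real.sqrt_mul (Finset.sum_nonneg fun i _ => by positivity)]
  refine Real.sqrt_le_sqrt ?_
  calc _ ≤ C * A * n := mul_le_mul h2 hn (Finset.sum_nonneg fun i _ => hN i) (by positivity)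
    _ = C * (n * A) := by ring

/-- Lower bound for the overlap of a density with the partitioned estimator, in terms of a lower
step function for the density. -/
theorem le_integral_min {S : Multiset (ℝ × ℝ)} (hS : 0 < S.card) {ℓ : ℕ} {w v : ℝ}
    (hwdef : segmentWidth (S.map Prod.fst) ℓ = w) (hvdef : segmentWidth (S.map Prod.snd) ℓ = v)
    (hw : 0 < w) (hv : 0 < v) {f : ℝ × ℝ → ℝ} (hf : Integrable f) (hf0 : ∀ p, 0 ≤ f p) {R : ℕ}
    {c : ℕ × ℕ → ℝ} {C ε δ : ℝ} (hc0 : ∀ i ∈ cellIndices ℓ, 0 ≤ c i)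
    (hC : 0 ≤ C) (hcC : ∀ i ∈ cellIndices ℓ, c i ≤ C)
    (hcf : ∀ i ∈ cellIndices ℓ, ∀ p ∈ cellRect S ℓ i, c i ≤ f p)
    (hbox : ∀ i ∈ cellIndices ℓ, 0 < c i →
      cellRect S ℓ i ⊆ Set.Ico (-R : ℝ) R ×ˢ Set.Ico (-R : ℝ) R)
    (hM : ∑ i ∈ cellIndices ℓ, c i * (w * v) ≤ 1) (hA : 1 ≤ S.card * (w * v)) (hδ : 0 ≤ δ)
    {j₁ k₁ j₂ k₂ : ℕ}
    (hdef₁ : ∀ T ⊆ dyadicBox R j₁ k₁, S.card * (∫ p in ⋃ q ∈ T, dyadicCell j₁ k₁ q, f p) -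
      pointCount S (⋃ q ∈ T, dyadicCell j₁ k₁ q) ≤ S.card * ε)
    (hdef₂ : ∀ T ⊆ dyadicBox R j₂ k₂, S.card * (∫ p in ⋃ q ∈ T, dyadicCell j₂ k₂ q, f p) -
      pointCount S (⋃ q ∈ T, dyadicCell j₂ k₂ q) ≤ S.card * ε)
    (hj₁ : 1 / 2 ^ j₁ ≤ δ * w / Real.sqrt (S.card * (w * v))) (hk₁ : 1 / 2 ^ k₁ ≤ δ * v)
    (hj₂ : 1 / 2 ^ j₂ ≤ δ * w) (hk₂ : 1 / 2 ^ k₂ ≤ δ * v / Real.sqrt (S.card * (w * v))) :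
    3 * ∑ i ∈ cellIndices ℓ, c i * (w * v) - 2 - 8 * (ℓ * Real.sqrt S.card + ℓ ^ 2) / S.card -
      5 * ε - (4 * Real.sqrt C + 16) * δ ≤ ∫ p, min (f p) (partitionedDensity S ℓ p) := by
  classical
  set n : ℝ := (S.card : ℝ) with hndef
  have hn : 0 < n := by rw [hndef]; exact_mod_cast hS
  set F := cellIndices ℓ with hF
  set N : ℕ × ℕ → ℝ := fun i => ((cellSample S ℓ i.1 i.2).card : ℝ) with hNdef
  have hN0 : ∀ i, 0 ≤ N i := fun i => by positivity
  set α : ℕ × ℕ → ℝ := fun i => segmentLeft (S.map Prod.fst) ℓ i.1 with hα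
  set β : ℕ × ℕ → ℝ := fun i => segmentLeft (S.map Prod.snd) ℓ i.2 with hβ
  have hα1 : ∀ i : ℕ × ℕ, segmentLeft (S.map Prod.fst) ℓ (i.1 + 1) = α i + w := fun i => by
    rw [← segmentLeft_add_width, hwdef]
  have hβ1 : ∀ i : ℕ × ℕ, segmentLeft (S.map Prod.snd) ℓ (i.2 + 1) = β i + v := fun i => by
    rw [← segmentLeft_add_width, hvdef]
  have hrect : ∀ i, cellRect S ℓ i = Set.Ico (α i) (α i + w) ×ˢ Set.Ico (β i) (β i + v) :=
    fun i => by rw [cellRect, hα1, hβ1]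
  have hsub : ∀ i, Set.Ioo (α i) (α i + w) ×ˢ Set.Ioo (β i) (β i + v) ⊆ cellRect S ℓ i := fun i => by
    rw [hrect]; exact Set.prod_mono Set.Ioo_subset_Ico_self Set.Ioo_subset_Ico_self
  have hrdisj := pairwiseDisjoint_cellRect S ℓ
  set sX : ℕ × ℕ → Multiset ℝ := fun i => (cellSample S ℓ i.1 i.2).map Prod.fst with hsX
  set sY : ℕ × ℕ → Multiset ℝ := fun i => (cellSample S ℓ i.1 i.2).map Prod.snd with hsY
  have hcardX : ∀ i, (sX i).card = (cellSample S ℓ i.1 i.2).card := fun i => Multiset.card_map _ _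
  have hcardY : ∀ i, (sY i).card = (cellSample S ℓ i.1 i.2).card := fun i => Multiset.card_map _ _
  have hmemX : ∀ i ∈ F, ∀ x ∈ sX i, x ∈ Set.Icc (α i) (α i + w) := by
    intro i hi x hx
    obtain ⟨p, hp, rfl⟩ := Multiset.mem_map.1 hx
    rw [← hα1]
    exact rangeSegment_subset _ (mem_cellIndices.1 hi).1 (mem_of_mem_cellSample hp).1
  have hmemY : ∀ i ∈ F, ∀ y ∈ sY i, y ∈ Set.Icc (β i) (β i + v) := by
    intro i hi x hx
    obtain ⟨p, hp, rfl⟩ := Multiset.mem_map.1 hx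
    rw [← hβ1]
    exact rangeSegment_subset _ (mem_cellIndices.1 hi).2 (mem_of_mem_cellSample hp).2
  set A := w * v with hAdef
  have hA0 : 0 < A := by positivity
  set M := ∑ i ∈ F, c i * A with hMdef
  have hNsum : ∑ i ∈ F, N i ≤ n := by
    simp only [hndef, hNdef]; exact_mod_cast sum_card_cellSample_le S ℓ
  have hsq1 : 1 ≤ Real.sqrt (n * A) := Real.one_le_sqrt.2 hA
  have hsq0 : 0 < Real.sqrt (n * A) := by linarith
  have hroot : (∑ i ∈ F, c i * A * Real.sqrt (N i)) / Real.sqrt (n * A) ≤ Real.sqrt C := by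
    rw [div_le_iff₀ hsq0]
    exact sum_mul_sqrt_le hA0.le hC hc0 hcC hN0 hM hNsum
  -- the total deficit of whole cells
  have hD : ∑ i ∈ F, max (n * (c i * A) - N i) 0 ≤ n * (ε + 4 * δ) := by
    set F' := F.filter fun i => 0 < n * (c i * A) - N i with hF'
    have hF'F : F' ⊆ F := Finset.filter_subset _ _
    have hb := sum_box_deficit_le (S := S) hf hn.le hdef₁ F' (x₀ := α) (x₁ := fun i => α i + w)
      (y₀ := β) (y₁ := fun i => β i + v) (c := c) (fun i _ => by linarith) (fun i _ => by linarith)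
      (fun i hi => hc0 i (hF'F hi)) (fun i hi p hp => hcf i (hF'F hi) p (hsub i hp))
      (fun i hi h => (hsub i).trans (hbox i (hF'F hi) h))
      (fun i hi j hj hne => (hrdisj (hF'F hi) (hF'F hj) hne).mono (hsub i) (hsub j))
    simp only [add_sub_cancel_left] at hb
    calc ∑ i ∈ F, max (n * (c i * A) - N i) 0 = ∑ i ∈ F', (n * (c i * A) - N i) := by
          rw [hF', Finset.sum_filter]
          refine Finset.sum_congr rfl fun i _ => ?_
          split_ifs with h
          · exact max_eq_left h.le
          · exact max_eq_right (not_lt.1 h)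
      _ ≤ _ := Finset.sum_le_sum fun i hi => by
          refine sub_le_sub_left ?_ _
          have := pointCount_le_cellSample (hF'F hi) Prod.fst (hsub i) (B := Set.univ)
            fun _ _ => Set.mem_univ _
          rwa [pointCount_univ, Multiset.card_map] at this
      _ ≤ _ := hb
      _ ≤ n * (ε + 4 * δ) := by
          refine mul_le_mul_of_nonneg_left (add_le_add_right ?_ ε) hn.le
          calc _ ≤ ∑ i ∈ F', 4 * δ * (c i * A) := Finset.sum_le_sum fun i hi => by
                have h1 : 1 / 2 ^ j₁ ≤ δ * w := hj₁.trans (div_le_self (by positivity) hsq1)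
                have h2 := hc0 i (hF'F hi)
                calc c i * (2 * (1 / 2 ^ j₁) * v + 2 * (1 / 2 ^ k₁) * w) ≤
                      c i * (2 * (δ * w) * v + 2 * (δ * v) * w) := by gcongr
                  _ = 4 * δ * (c i * A) := by rw [hAdef]; ring
            _ ≤ ∑ i ∈ F, 4 * δ * (c i * A) :=
                Finset.sum_le_sum_of_subset_of_nonneg hF'F fun i hi _ => by
                  have := hc0 i hi; positivity
            _ ≤ 4 * δ := by
                rw [← Finset.mul_sum]; exact mul_le_of_le_one_right (by positivity) hM
  -- The excess of a cell is its signed difference plus its deficit. The counts add up to at most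
  -- `n`, so a bound for the deficits also bounds the excesses, and no upper deviation inequality is
  -- needed.
  have hexc : ∑ i ∈ F, max (N i - n * (c i * A)) 0 ≤ n - n * M + n * (ε + 4 * δ) := by
    have h1 : ∀ i ∈ F, max (N i - n * (c i * A)) 0 =
        N i - n * (c i * A) + max (n * (c i * A) - N i) 0 := fun i _ => by
      rcases le_total (N i) (n * (c i * A)) with h | h
      · rw [max_eq_right (by linarith), max_eq_left (by linarith)]; ring
      · rw [max_eq_left (by linarith), max_eq_right (by linarith)]; ring
    rw [Finset.sum_congr rfl h1, Finset.sum_add_distrib, Finset.sum_sub_distrib, ← Finset.mul_sum]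
    linarith
  -- Here `t` and `τ` are the mesh widths relative to the cell sides. The extra factor `1 / √(n *
  -- A)` in `t` cancels the growth of the number of strips.
  have hloss : ∀ t τ, t ≤ δ / Real.sqrt (n * A) → τ ≤ δ →
      ∑ i ∈ F, c i * A * (2 * t * Real.sqrt (N i) + 2 * τ) ≤ 2 * δ * Real.sqrt C + 2 * δ := by
    intro t τ ht hτ
    calc _ ≤ ∑ i ∈ F, c i * A * (2 * (δ / Real.sqrt (n * A)) * Real.sqrt (N i) + 2 * δ) :=
          Finset.sum_le_sum fun i hi => by
            have := hc0 i hi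
            gcongr
      _ = 2 * δ * ((∑ i ∈ F, c i * A * Real.sqrt (N i)) / Real.sqrt (n * A)) + 2 * δ * M := by
          rw [hMdef, Finset.sum_div, Finset.mul_sum, Finset.mul_sum, ← Finset.sum_add_distrib]
          exact Finset.sum_congr rfl fun i _ => by ring
      _ ≤ 2 * δ * Real.sqrt C + 2 * δ := by
          have h1 := mul_le_mul_of_nonneg_left hroot (show 0 ≤ 2 * δ by positivity)
          have h2 := mul_le_mul_of_nonneg_left hM (show 0 ≤ 2 * δ by positivity)
          linarith
  set UX : ℕ × ℕ → ℝ := fun i =>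
    ∫ x in Set.Ioo (α i) (α i + w), min (1 / w) (spacingDensity (sX i) x) with hUX
  set UY : ℕ × ℕ → ℝ := fun i =>
    ∫ y in Set.Ioo (β i) (β i + v), min (1 / v) (spacingDensity (sY i) y) with hUY
  -- The strips are thin in the first coordinate only, so the mesh `j₁`, `k₁` is refined in that
  -- direction alone. Refining both would produce too many rectangles; the other direction has its
  -- own mesh `j₂`, `k₂`.
  have hEX : ∑ i ∈ F, N i * (1 - UX i) ≤ ∑ i ∈ F, (4 * spacingParam (cellSample S ℓ i.1 i.2).card : ℝ)
      + ∑ i ∈ F, max (N i - n * (c i * A)) 0 + n * (ε + (2 * δ * Real.sqrt C + 2 * δ)) := by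
    have h := sum_missing_mass_le (F := F) (s := sX) (α := α) (c := c) (ε := ε)
      (t := 1 / 2 ^ j₁) (τ := 1 / 2 ^ k₁) hw hv hn.le (by positivity) (by positivity) hc0 hmemX
      (by
        intro T lo hi hTF hT hd
        have hsubT : ∀ p ∈ T, Set.Ioo (lo p) (hi p) ×ˢ Set.Ioo (β p.1) (β p.1 + v) ⊆
            Set.Ioo (α p.1) (α p.1 + w) ×ˢ Set.Ioo (β p.1) (β p.1 + v) := fun p hp =>
          Set.prod_mono (Set.Ioo_subset_Ioo (hT p hp).1 (hT p hp).2.2) le_rfl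
        have hb := sum_box_deficit_le (S := S) hf hn.le hdef₁ T (x₀ := lo) (x₁ := hi)
          (y₀ := fun p => β p.1) (y₁ := fun p => β p.1 + v) (c := fun p => c p.1)
          (fun p hp => (hT p hp).2.1) (fun p _ => by linarith) (fun p hp => hc0 p.1 (hTF p hp))
          (fun p hp z hz => hcf p.1 (hTF p hp) z (hsub _ (hsubT p hp hz)))
          (fun p hp h => ((hsubT p hp).trans (hsub _)).trans (hbox p.1 (hTF p hp) h))
          (by
            intro p hp q hq hne
            by_cases h : p.1 = q.1
            · exact Set.disjoint_prod.2 (Or.inl (hd p hp q hq hne h))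
            · exact (hrdisj (hTF p hp) (hTF q hq) h).mono ((hsubT p hp).trans (hsub _))
                ((hsubT q hq).trans (hsub _)))
        simp only [add_sub_cancel_left] at hb
        refine le_trans (Finset.sum_le_sum fun p hp => sub_le_sub_left ?_ _) hb
        exact pointCount_le_cellSample (hTF p hp) Prod.fst ((hsubT p hp).trans (hsub _))
          fun z hz => hz.1)
    simp only [hcardX] at h
    refine h.trans (add_le_add_right (mul_le_mul_of_nonneg_left (add_le_add_right ?_ ε) hn.le) _)
    refine le_trans (le_of_eq (Finset.sum_congr rfl fun i _ => ?_))
      (hloss (1 / 2 ^ j₁ / w) (1 / 2 ^ k₁ / v) ?_ ?_)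
    · simp only [hAdef, hNdef]; field_simp
    · rw [div_le_iff₀ hw]; refine hj₁.trans (le_of_eq (by ring))
    · rw [div_le_iff₀ hv]; exact hk₁
  have hEY : ∑ i ∈ F, N i * (1 - UY i) ≤ ∑ i ∈ F, (4 * spacingParam (cellSample S ℓ i.1 i.2).card : ℝ)
      + ∑ i ∈ F, max (N i - n * (c i * A)) 0 + n * (ε + (2 * δ * Real.sqrt C + 2 * δ)) := by
    have h := sum_missing_mass_le (F := F) (s := sY) (α := β) (c := c) (ε := ε)
      (t := 1 / 2 ^ k₂) (τ := 1 / 2 ^ j₂) hv hw hn.le (by positivity) (by positivity) hc0 hmemY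
      (by
        intro T lo hi hTF hT hd
        have hsubT : ∀ p ∈ T, Set.Ioo (α p.1) (α p.1 + w) ×ˢ Set.Ioo (lo p) (hi p) ⊆
            Set.Ioo (α p.1) (α p.1 + w) ×ˢ Set.Ioo (β p.1) (β p.1 + v) := fun p hp =>
          Set.prod_mono le_rfl (Set.Ioo_subset_Ioo (hT p hp).1 (hT p hp).2.2)
        have hb := sum_box_deficit_le (S := S) hf hn.le hdef₂ T (y₀ := lo) (y₁ := hi)
          (x₀ := fun p => α p.1) (x₁ := fun p => α p.1 + w) (c := fun p => c p.1)
          (fun p _ => by linarith) (fun p hp => (hT p hp).2.1) (fun p hp => hc0 p.1 (hTF p hp))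
          (fun p hp z hz => hcf p.1 (hTF p hp) z (hsub _ (hsubT p hp hz)))
          (fun p hp h => ((hsubT p hp).trans (hsub _)).trans (hbox p.1 (hTF p hp) h))
          (by
            intro p hp q hq hne
            by_cases h : p.1 = q.1
            · exact Set.disjoint_prod.2 (Or.inr (hd p hp q hq hne h))
            · exact (hrdisj (hTF p hp) (hTF q hq) h).mono ((hsubT p hp).trans (hsub _))
                ((hsubT q hq).trans (hsub _)))
        simp only [add_sub_cancel_left] at hb
        refine le_trans (Finset.sum_le_sum fun p hp => ?_) (hb.trans (le_of_eq ?_))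
        · rw [mul_comm w]
          refine sub_le_sub_left ?_ _
          exact pointCount_le_cellSample (hTF p hp) Prod.snd ((hsubT p hp).trans (hsub _))
            fun z hz => hz.2
        · congr 2
          exact Finset.sum_congr rfl fun p _ => by ring)
    simp only [hcardY, mul_comm v w] at h
    refine h.trans (add_le_add_right (mul_le_mul_of_nonneg_left (add_le_add_right ?_ ε) hn.le) _)
    refine le_trans (le_of_eq (Finset.sum_congr rfl fun i _ => ?_))
      (hloss (1 / 2 ^ k₂ / v) (1 / 2 ^ j₂ / w) ?_ ?_)
    · simp only [hAdef, hNdef]; field_simp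
    · rw [div_le_iff₀ hv]; refine hk₂.trans (le_of_eq (by ring))
    · rw [div_le_iff₀ hw]; exact hj₂
  have hfhat := integrable_partitionedDensity S ℓ
  have hminint : Integrable fun p => min (f p) (partitionedDensity S ℓ p) := hf.inf hfhat
  have hmin0 : ∀ p, 0 ≤ min (f p) (partitionedDensity S ℓ p) := fun p =>
    le_min (hf0 p) (partitionedDensity_nonneg S ℓ p)
  have hms : ∀ i, MeasurableSet (Set.Ioo (α i) (α i + w) ×ˢ Set.Ioo (β i) (β i + v)) := fun i =>
    measurableSet_Ioo.prod measurableSet_Ioo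
  have hcells : ∑ i ∈ F, (∫ p in Set.Ioo (α i) (α i + w) ×ˢ Set.Ioo (β i) (β i + v),
      min (f p) (partitionedDensity S ℓ p)) ≤ ∫ p, min (f p) (partitionedDensity S ℓ p) := by
    rw [← integral_biUnion_finset F (fun i _ => hms i)
      (fun i hi j hj hne => (hrdisj hi hj hne).mono (hsub i) (hsub j))
      (fun i _ => hminint.integrableOn)]
    exact setIntegral_le_integral hminint (ae_of_all _ hmin0)
  -- Expand `UX * UY` by `UX * UY ≥ 1 - (1 - UX) - (1 - UY)`, valid as both factors are at most `1`.
  -- The errors of the two directions then add up.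
  have hcell : ∀ i ∈ F, c i * A - max (n * (c i * A) - N i) 0 / n - N i * (1 - UX i) / n -
      N i * (1 - UY i) / n ≤ ∫ p in Set.Ioo (α i) (α i + w) ×ˢ Set.Ioo (β i) (β i + v),
        min (f p) (partitionedDensity S ℓ p) := by
    intro i hi
    have h1 := mul_le_setIntegral_min (gX := sX i) (gY := sY i) (x₀ := α i) (x₁ := α i + w)
      (y₀ := β i) (y₁ := β i + v) (c := c i) (q := N i / n) (by linarith) (by linarith)
      (hc0 i hi) (by have := hN0 i; positivity)
    have hX := setIntegral_min_mem_Icc (sX i) (show α i < α i + w by linarith)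
    have hY := setIntegral_min_mem_Icc (sY i) (show β i < β i + v by linarith)
    simp only [add_sub_cancel_left] at h1 hX hY
    have h2 : ∫ p in Set.Ioo (α i) (α i + w) ×ˢ Set.Ioo (β i) (β i + v),
        min (c i) (N i / n * (spacingDensity (sX i) p.1 * spacingDensity (sY i) p.2)) ≤
        ∫ p in Set.Ioo (α i) (α i + w) ×ˢ Set.Ioo (β i) (β i + v),
          min (f p) (partitionedDensity S ℓ p) := by
      have hg : Integrable fun p : ℝ × ℝ =>
          N i / n * (spacingDensity (sX i) p.1 * spacingDensity (sY i) p.2) :=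
        ((integrable_spacingDensity _).mul_prod (integrable_spacingDensity _)).const_mul _
      have hfin : volume (Set.Ioo (α i) (α i + w) ×ˢ Set.Ioo (β i) (β i + v)) ≠ ⊤ := by
        rw [Measure.volume_eq_prod, Measure.prod_prod]
        exact ENNReal.mul_ne_top (by simp) (by simp)
      refine setIntegral_mono_on
        (Integrable.inf (integrableOn_const hfin : IntegrableOn (fun _ : ℝ × ℝ => c i) _ _)
          hg.integrableOn) hminint.integrableOn (hms i) fun p hp => ?_
      refine min_le_min (hcf i hi p (hsub i hp)) ?_
      rw [partitionedDensity_eq]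
      refine Finset.single_le_sum (f := fun i : ℕ × ℕ => ((cellSample S ℓ i.1 i.2).card : ℝ) / S.card *
        (spacingDensity ((cellSample S ℓ i.1 i.2).map Prod.fst) p.1 *
        spacingDensity ((cellSample S ℓ i.1 i.2).map Prod.snd) p.2)) (fun j _ => ?_) hi
      have := spacingDensity_nonneg ((cellSample S ℓ j.1 j.2).map Prod.fst) p.1
      have := spacingDensity_nonneg ((cellSample S ℓ j.1 j.2).map Prod.snd) p.2
      positivity
    refine le_trans ?_ (h1.trans h2)
    have hmin : min (c i * (w * v)) (N i / n) = c i * A - max (n * (c i * A) - N i) 0 / n := by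
      rcases le_total (c i * A) (N i / n) with h | h
      · rw [min_eq_left h, max_eq_right, zero_div, sub_zero]
        rw [le_div_iff₀ hn] at h; linarith
      · rw [min_eq_right h, max_eq_left]
        · field_simp; ring
        · rw [div_le_iff₀ hn] at h; linarith
    rw [← hmin]
    have h3 : min (c i * (w * v)) (N i / n) ≤ N i / n := min_le_right _ _
    have h4 : 0 ≤ min (c i * (w * v)) (N i / n) :=
      le_min (mul_nonneg (hc0 i hi) hA0.le) (by have := hN0 i; positivity)
    set μ := min (c i * (w * v)) (N i / n)
    have h5 : μ * (1 - UX i) ≤ N i * (1 - UX i) / n := by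
      rw [mul_div_right_comm]; exact mul_le_mul_of_nonneg_right h3 (by linarith [hX.2])
    have h6 : μ * (1 - UY i) ≤ N i * (1 - UY i) / n := by
      rw [mul_div_right_comm]; exact mul_le_mul_of_nonneg_right h3 (by linarith [hY.2])
    have h7 : 0 ≤ μ * ((1 - UX i) * (1 - UY i)) :=
      mul_nonneg h4 (mul_nonneg (by linarith [hX.2]) (by linarith [hY.2]))
    have h8 : μ * (UX i * UY i) = μ - μ * (1 - UX i) - μ * (1 - UY i) +
      μ * ((1 - UX i) * (1 - UY i)) := by ring
    linarith
  have hfinal := (Finset.sum_le_sum hcell).trans hcells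
  rw [Finset.sum_sub_distrib, Finset.sum_sub_distrib, Finset.sum_sub_distrib, ← Finset.sum_div,
    ← Finset.sum_div, ← Finset.sum_div, ← hMdef] at hfinal
  have hm := sum_spacingParam_le S ℓ
  rw [← Finset.mul_sum] at hEX hEY
  have hsum : (∑ i ∈ F, max (n * (c i * A) - N i) 0 + ∑ i ∈ F, N i * (1 - UX i) +
      ∑ i ∈ F, N i * (1 - UY i)) / n ≤ (n * (ε + 4 * δ) +
      2 * (4 * (ℓ * Real.sqrt n + ℓ ^ 2) + (n - n * M + n * (ε + 4 * δ)) +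
        n * (ε + (2 * δ * Real.sqrt C + 2 * δ)))) / n :=
    div_le_div_of_nonneg_right (by linarith) hn.le
  -- The excess of the cells, at most `n * (1 - M)` up to small terms, enters once for each
  -- direction; hence `3 * M - 2 = M - 2 * (1 - M)`.
  have heq : M - (n * (ε + 4 * δ) +
      2 * (4 * (ℓ * Real.sqrt n + ℓ ^ 2) + (n - n * M + n * (ε + 4 * δ)) +
        n * (ε + (2 * δ * Real.sqrt C + 2 * δ)))) / n =
      3 * M - 2 - 8 * (ℓ * Real.sqrt n + ℓ ^ 2) / n - 5 * ε - (4 * Real.sqrt C + 16) * δ := by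
    field_simp; ring
  rw [add_div, add_div] at hsum
  linarith

/-! ### Almost sure deficit control and the size of the cells. -/

/-- The empirical measures of the samples `S n` do not fall short of the density `f` on unions of
dyadic rectangles of bounded regions, uniformly over all meshes with a small multiple of `n`
rectangles. -/
def HasSmallDeficit (f : ℝ × ℝ → ℝ) (S : ℕ → Multiset (ℝ × ℝ)) : Prop :=
  ∀ R : ℕ, 0 < R → ∀ ε > 0, ∃ θ > 0, ∀ᶠ n : ℕ in atTop, ∀ j k : ℕ, (2 : ℝ) ^ (j + k) ≤ θ * n →
    ∀ T ⊆ dyadicBox R j k, n * (∫ p in ⋃ q ∈ T, dyadicCell j k q, f p) -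
      pointCount (S n) (⋃ q ∈ T, dyadicCell j k q) ≤ n * ε

/-- Restricting to `ε = 1 / (q + 1)` and integral `R` leaves countably many exceptional null sets.
All later arguments are deterministic, for a fixed outcome. -/
theorem ae_hasSmallDeficit {Ω : Type*} [MeasurableSpace Ω] {P : Measure Ω} [IsProbabilityMeasure P]
    {f : ℝ × ℝ → ℝ} (hf_meas : Measurable f) (hf_nonneg : ∀ p, 0 ≤ f p)
    {Z : ℕ → Ω → ℝ × ℝ} (hZ_meas : ∀ i, Measurable (Z i)) (hZ_indep : iIndepFun Z P)
    (hZ_law : ∀ i, P.map (Z i) = volume.withDensity fun p => ENNReal.ofReal (f p)) :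
    ∀ᵐ ω ∂P, HasSmallDeficit f fun n => firstSample Z n ω := by
  have key : ∀ R q : ℕ, ∃ θ > 0, 0 < R → ∀ᵐ ω ∂P, ∀ᶠ n : ℕ in atTop, ∀ j k : ℕ,
      (2 : ℝ) ^ (j + k) ≤ θ * n → ∀ T ⊆ dyadicBox R j k,
        n * (volume.withDensity fun p => ENNReal.ofReal (f p)).real (⋃ q ∈ T, dyadicCell j k q) -
        pointCount (firstSample Z n ω) (⋃ q ∈ T, dyadicCell j k q) < n * (1 / ((q : ℝ) + 1)) := by
    intro R q
    by_cases hR : 0 < R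
    · obtain ⟨θ, hθ, h⟩ := ae_eventually_dyadic_deficit_lt hZ_meas hZ_indep hZ_law R hR
        (ε := 1 / ((q : ℝ) + 1)) (by positivity)
      exact ⟨θ, hθ, fun _ => h⟩
    · exact ⟨1, one_pos, fun h => absurd h hR⟩
  choose θ hθ h using key
  have hall : ∀ᵐ ω ∂P, ∀ R q : ℕ, 0 < R → ∀ᶠ n : ℕ in atTop, ∀ j k : ℕ,
      (2 : ℝ) ^ (j + k) ≤ θ R q * n → ∀ T ⊆ dyadicBox R j k,
        n * (volume.withDensity fun p => ENNReal.ofReal (f p)).real (⋃ q ∈ T, dyadicCell j k q) -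
        pointCount (firstSample Z n ω) (⋃ q ∈ T, dyadicCell j k q) < n * (1 / ((q : ℝ) + 1)) := by
    refine ae_all_iff.2 fun R => ae_all_iff.2 fun q => ?_
    by_cases hR : 0 < R
    · filter_upwards [h R q hR] with ω hω _ using hω
    · exact ae_of_all _ fun ω h => absurd h hR
  filter_upwards [hall] with ω hω R hR ε hε
  obtain ⟨q, hq⟩ := exists_nat_one_div_lt hε
  refine ⟨θ R q, hθ R q, ?_⟩
  filter_upwards [hω R q hR] with n hn j k hjk T hT
  have h1 := hn j k hjk T hT
  have hmeas : MeasurableSet (⋃ q ∈ T, dyadicCell j k q) :=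
    Finset.measurableSet_biUnion _ fun q _ => measurableSet_dyadicCell _ _ _
  rw [measureReal_def, withDensity_apply _ hmeas, ← integral_eq_lintegral_of_nonneg_ae
    (ae_of_all _ hf_nonneg) hf_meas.aestronglyMeasurable] at h1
  have h2 : (n : ℝ) * (1 / ((q : ℝ) + 1)) ≤ n * ε := by gcongr
  linarith

theorem exists_mem_of_pointCount_pos {α : Type*} {S : Multiset α} {B : Set α}
    (h : 0 < pointCount S B) : ∃ x ∈ S, x ∈ B := by
  by_contra! hcon
  refine h.ne' (Multiset.sum_eq_zero fun y hy => ?_)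
  obtain ⟨x, hx, rfl⟩ := Multiset.mem_map.1 hy
  exact Set.indicator_of_notMem (hcon x hx) _

/-- The box has mass at least `c * r ^ 2`. A quarter of this is given to the deviation and a quarter
to the dyadic boundary loss, so the count is eventually at least `n * c * r ^ 2 / 2`. -/
theorem eventually_exists_mem_box {f : ℝ × ℝ → ℝ} (hf : Integrable f) {S : ℕ → Multiset (ℝ × ℝ)}
    (hS : HasSmallDeficit f S) {x y r c : ℝ} (hr : 0 < r) (hc : 0 < c)
    (hcf : ∀ p ∈ Set.Ioo x (x + r) ×ˢ Set.Ioo y (y + r), c ≤ f p) :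
    ∀ᶠ n in atTop, ∃ z ∈ S n, z ∈ Set.Ioo x (x + r) ×ˢ Set.Ioo y (y + r) := by
  obtain ⟨R, hR⟩ := exists_nat_gt (|x| + |y| + r)
  have hR0 : 0 < R := by
    have : (0 : ℝ) < R := by linarith [abs_nonneg x, abs_nonneg y]
    exact_mod_cast this
  obtain ⟨θ, hθ, hev⟩ := hS R hR0 (c * r ^ 2 / 4) (by positivity)
  obtain ⟨j, hj⟩ := exists_pow_lt_of_lt_one (show 0 < r / 16 by positivity)
    (show (1 / 2 : ℝ) < 1 by norm_num)
  have hlim : Tendsto (fun n : ℕ => θ * (n : ℝ)) atTop atTop :=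
    tendsto_natCast_atTop_atTop.const_mul_atTop hθ
  filter_upwards [hev, hlim.eventually_ge_atTop ((2 : ℝ) ^ (j + j)), eventually_gt_atTop 0]
    with n hn hn2 hn0
  have hn0' : (0 : ℝ) < n := by exact_mod_cast hn0
  have hb := sum_box_deficit_le (S := S n) hf hn0'.le (hn j j hn2) ({()} : Finset Unit)
    (x₀ := fun _ => x) (x₁ := fun _ => x + r) (y₀ := fun _ => y) (y₁ := fun _ => y + r)
    (c := fun _ => c) (fun _ _ => by linarith) (fun _ _ => by linarith) (fun _ _ => hc.le)
    (fun _ _ => hcf)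
    (fun _ _ _ p hp => by
      have := neg_abs_le x; have := le_abs_self x
      have := neg_abs_le y; have := le_abs_self y
      have := abs_nonneg x; have := abs_nonneg y
      exact ⟨⟨by linarith [hp.1.1], by linarith [hp.1.2]⟩,
        ⟨by linarith [hp.2.1], by linarith [hp.2.2]⟩⟩)
    (by simp)
  simp only [Finset.sum_singleton, add_sub_cancel_left] at hb
  refine exists_mem_of_pointCount_pos ?_
  have hj' : (1 : ℝ) / 2 ^ j ≤ r / 16 := by rw [← one_div_pow]; exact hj.le
  have h1 : c * (2 * (1 / 2 ^ j) * r + 2 * (1 / 2 ^ j) * r) ≤ c * r ^ 2 / 4 := by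
    calc _ ≤ c * (2 * (r / 16) * r + 2 * (r / 16) * r) := by gcongr
      _ = _ := by ring
  have h2 : 0 < n * (c * r ^ 2 / 2) := by positivity
  nlinarith [mul_le_mul_of_nonneg_left h1 hn0'.le]

/-- A continuity point with positive density eventually has sample points strictly below and
strictly above it in both coordinates. -/
theorem eventually_exists_lt_and_gt {f : ℝ × ℝ → ℝ} (hf : Integrable f) {S : ℕ → Multiset (ℝ × ℝ)}
    (hS : HasSmallDeficit f S) {p : ℝ × ℝ} (hp : ContinuousAt f p) (hpos : 0 < f p) :
    ∀ᶠ n in atTop, (∃ z ∈ S n, z.1 < p.1 ∧ z.2 < p.2) ∧ ∃ z ∈ S n, p.1 < z.1 ∧ p.2 < z.2 := by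
  have h1 : ∀ᶠ q in 𝓝 p, f p / 2 < f q := hp.eventually (lt_mem_nhds (by linarith))
  obtain ⟨r, hr, hball⟩ := Metric.eventually_nhds_iff.1 h1
  have hlow := eventually_exists_mem_box hf hS (x := p.1 - r) (y := p.2 - r) (r := r)
    (c := f p / 2) hr (by linarith) (fun q hq => (hball (by
      rw [Prod.dist_eq, max_lt_iff, Real.dist_eq, Real.dist_eq, abs_lt, abs_lt]
      obtain ⟨⟨_, _⟩, ⟨_, _⟩⟩ := hq
      exact ⟨⟨by linarith, by linarith⟩, ⟨by linarith, by linarith⟩⟩)).le)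
  have hup := eventually_exists_mem_box hf hS (x := p.1) (y := p.2) (r := r)
    (c := f p / 2) hr (by linarith) (fun q hq => (hball (by
      rw [Prod.dist_eq, max_lt_iff, Real.dist_eq, Real.dist_eq, abs_lt, abs_lt]
      obtain ⟨⟨_, _⟩, ⟨_, _⟩⟩ := hq
      exact ⟨⟨by linarith, by linarith⟩, ⟨by linarith, by linarith⟩⟩)).le)
  filter_upwards [hlow, hup] with n ⟨z, hz, hz'⟩ ⟨u, hu, hu'⟩
  exact ⟨⟨z, hz, by linarith [hz'.1.2], by linarith [hz'.2.2]⟩, ⟨u, hu, hu'.1.1, hu'.2.1⟩⟩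

theorem exists_continuousAt_pos {f : ℝ × ℝ → ℝ} (hf0 : ∀ p, 0 ≤ f p) (hf1 : ∫ p, f p = 1)
    (hcont : ∀ᵐ p : ℝ × ℝ, ContinuousAt f p) : ∃ p, ContinuousAt f p ∧ 0 < f p := by
  by_contra! h
  have : f =ᵐ[volume] 0 := by
    filter_upwards [hcont] with p hp using le_antisymm (h p hp) (hf0 p)
  rw [integral_congr_ae this] at hf1
  simp at hf1

theorem sub_div_le_segmentWidth {s : Multiset ℝ} {x y : ℝ} (hx : x ∈ s) (hy : y ∈ s) (ℓ : ℕ) :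
    (y - x) / ℓ ≤ segmentWidth s ℓ := by
  have h1 := orderStat_one_le hx
  have h2 := le_orderStat_card hy
  unfold segmentWidth
  gcongr

/-- Two sample points that differ in both coordinates stay in all later samples, so the ranges are
bounded below. The area of a cell is then at least a constant over `ℓ ^ 2`, which is large compared
with `1 / n`. -/
theorem eventually_le_mul_area {f : ℝ × ℝ → ℝ} (hf : Integrable f) (hf0 : ∀ p, 0 ≤ f p)
    (hf1 : ∫ p, f p = 1) (hcont : ∀ᵐ p : ℝ × ℝ, ContinuousAt f p) {S : ℕ → Multiset (ℝ × ℝ)}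
    (hmono : Monotone S) (hS : HasSmallDeficit f S) {ℓ : ℕ → ℕ} (hℓ_top : Tendsto ℓ atTop atTop)
    (hℓ_sq : (fun n => (ℓ n : ℝ) ^ 2) =o[atTop] fun n => (n : ℝ)) (K : ℝ) :
    ∀ᶠ n in atTop, 0 < segmentWidth ((S n).map Prod.fst) (ℓ n) ∧
      0 < segmentWidth ((S n).map Prod.snd) (ℓ n) ∧
      K ≤ n * (segmentWidth ((S n).map Prod.fst) (ℓ n) *
        segmentWidth ((S n).map Prod.snd) (ℓ n)) := by
  obtain ⟨p, hp, hpos⟩ := exists_continuousAt_pos hf0 hf1 hcont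
  obtain ⟨n₀, ⟨z, hz, hz1, hz2⟩, u, hu, hu1, hu2⟩ := (eventually_exists_lt_and_gt hf hS hp hpos).exists
  have hρ : 0 < u.1 - z.1 := by linarith
  have hσ : 0 < u.2 - z.2 := by linarith
  have hK : 0 < max K 1 := by positivity
  filter_upwards [eventually_ge_atTop n₀, hℓ_top.eventually_gt_atTop 0,
    hℓ_sq.bound (show 0 < (u.1 - z.1) * (u.2 - z.2) / max K 1 by positivity)] with n hn hℓ hb
  have hℓ' : (0 : ℝ) < ℓ n := by exact_mod_cast hℓ
  have hz' := Multiset.mem_of_le (hmono hn) hz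
  have hu' := Multiset.mem_of_le (hmono hn) hu
  have hw := sub_div_le_segmentWidth (Multiset.mem_map_of_mem Prod.fst hz')
    (Multiset.mem_map_of_mem Prod.fst hu') (ℓ n)
  have hv := sub_div_le_segmentWidth (Multiset.mem_map_of_mem Prod.snd hz')
    (Multiset.mem_map_of_mem Prod.snd hu') (ℓ n)
  have hw0 : 0 < (u.1 - z.1) / ℓ n := by positivity
  have hv0 : 0 < (u.2 - z.2) / ℓ n := by positivity
  refine ⟨hw0.trans_le hw, hv0.trans_le hv, ?_⟩
  rw [Real.norm_of_nonneg (by positivity), Real.norm_of_nonneg (by positivity), div_mul_eq_mul_div,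
    le_div_iff₀ hK] at hb
  calc K ≤ max K 1 := le_max_left _ _
    _ ≤ n * ((u.1 - z.1) / ℓ n * ((u.2 - z.2) / ℓ n)) := by
        rw [div_mul_div_comm, ← mul_div_assoc, le_div_iff₀ (by positivity)]
        nlinarith
    _ ≤ _ := by
        have := hw0.le.trans hw
        gcongr

/-! ### Truncation and lower step functions. -/

/-- The truncation of `f` at height `m`, restricted to `(-m, m) ^ 2`. -/
noncomputable def boxTruncation (f : ℝ × ℝ → ℝ) (m : ℕ) : ℝ × ℝ → ℝ :=
  (Set.Ioo (-m : ℝ) m ×ˢ Set.Ioo (-m : ℝ) m).indicator fun p => min (f p) m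

section BoxTruncation

variable {f : ℝ × ℝ → ℝ} (m : ℕ)

theorem boxTruncation_nonneg (hf0 : ∀ p, 0 ≤ f p) (p : ℝ × ℝ) : 0 ≤ boxTruncation f m p :=
  Set.indicator_nonneg (fun q _ => le_min (hf0 q) (by positivity)) p

theorem boxTruncation_le (hf0 : ∀ p, 0 ≤ f p) (p : ℝ × ℝ) : boxTruncation f m p ≤ f p :=
  Set.indicator_le' (fun _ _ => min_le_left _ _) (fun q _ => hf0 q) p

theorem boxTruncation_le_natCast (p : ℝ × ℝ) : boxTruncation f m p ≤ m :=
  Set.indicator_le' (fun _ _ => min_le_right _ _) (fun _ _ => by simp) p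

theorem measurable_boxTruncation (hf : Measurable f) : Measurable (boxTruncation f m) :=
  (hf.min measurable_const).indicator (measurableSet_Ioo.prod measurableSet_Ioo)

theorem mem_of_boxTruncation_pos {p : ℝ × ℝ} (hp : 0 < boxTruncation f m p) :
    p ∈ Set.Ioo (-m : ℝ) m ×ˢ Set.Ioo (-m : ℝ) m := by
  by_contra h
  rw [boxTruncation, Set.indicator_of_notMem h] at hp
  exact lt_irrefl _ hp

/-- Positivity places `p` in the open box, so the jump of the indicator at its boundary does no
harm. Zeros of the truncation need no continuity, since there the lower step function vanishes as
well. -/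
theorem continuousAt_boxTruncation {p : ℝ × ℝ} (hp : ContinuousAt f p)
    (hpos : 0 < boxTruncation f m p) : ContinuousAt (boxTruncation f m) p := by
  have hopen : IsOpen (Set.Ioo (-m : ℝ) m ×ˢ Set.Ioo (-m : ℝ) m) := isOpen_Ioo.prod isOpen_Ioo
  have hev : boxTruncation f m =ᶠ[𝓝 p] fun q => min (f q) m := by
    filter_upwards [hopen.mem_nhds (mem_of_boxTruncation_pos m hpos)] with q hq
    exact Set.indicator_of_mem hq _
  exact (ContinuousAt.congr_of_eventuallyEq (hp.min continuousAt_const) hev)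

theorem tendsto_integral_boxTruncation (hf : Integrable f) (hfm : Measurable f)
    (hf0 : ∀ p, 0 ≤ f p) :
    Tendsto (fun m => ∫ p, boxTruncation f m p) atTop (𝓝 (∫ p, f p)) := by
  refine tendsto_integral_of_dominated_convergence f
    (fun m => (measurable_boxTruncation m hfm).aestronglyMeasurable) hf
    (fun m => ae_of_all _ fun p => ?_) (ae_of_all _ fun p => ?_)
  · rw [Real.norm_of_nonneg (boxTruncation_nonneg m hf0 p)]
    exact boxTruncation_le m hf0 p
  · obtain ⟨K, hK⟩ := exists_nat_gt (|p.1| + |p.2| + f p)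
    refine tendsto_const_nhds.congr' ?_
    filter_upwards [eventually_ge_atTop K] with m hm
    have hm' : (K : ℝ) ≤ m := by exact_mod_cast hm
    have h1 := abs_nonneg p.1
    have h2 := abs_nonneg p.2
    have h3 := hf0 p
    rw [boxTruncation, Set.indicator_of_mem, min_eq_left (by linarith)]
    exact ⟨abs_lt.1 (by linarith), abs_lt.1 (by linarith)⟩

end BoxTruncation

/-- The infimum of a function over a cell. -/
noncomputable def cellInf (g : ℝ × ℝ → ℝ) (S : Multiset (ℝ × ℝ)) (ℓ : ℕ) (i : ℕ × ℕ) : ℝ :=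
  sInf (g '' cellRect S ℓ i)

/-- The lower step function of a function on the cells of a sample. -/
noncomputable def lowerStep (g : ℝ × ℝ → ℝ) (S : Multiset (ℝ × ℝ)) (ℓ : ℕ) (p : ℝ × ℝ) : ℝ :=
  ∑ i ∈ cellIndices ℓ, (cellRect S ℓ i).indicator (fun _ => cellInf g S ℓ i) p

theorem cellInf_nonneg {g : ℝ × ℝ → ℝ} (hg : ∀ p, 0 ≤ g p) (S : Multiset (ℝ × ℝ)) (ℓ : ℕ)
    (i : ℕ × ℕ) : 0 ≤ cellInf g S ℓ i :=
  Real.sInf_nonneg (by rintro _ ⟨p, -, rfl⟩; exact hg p)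

theorem cellInf_le {g : ℝ × ℝ → ℝ} (hg : ∀ p, 0 ≤ g p) {S : Multiset (ℝ × ℝ)} {ℓ : ℕ} {i : ℕ × ℕ}
    {p : ℝ × ℝ} (hp : p ∈ cellRect S ℓ i) : cellInf g S ℓ i ≤ g p :=
  csInf_le ⟨0, by rintro _ ⟨q, -, rfl⟩; exact hg q⟩ ⟨p, hp, rfl⟩

theorem le_cellInf {g : ℝ × ℝ → ℝ} {S : Multiset (ℝ × ℝ)} {ℓ : ℕ} {i : ℕ × ℕ} {p : ℝ × ℝ} {b : ℝ}
    (hp : p ∈ cellRect S ℓ i) (hb : ∀ q ∈ cellRect S ℓ i, b ≤ g q) : b ≤ cellInf g S ℓ i :=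
  le_csInf ⟨_, p, hp, rfl⟩ (by rintro _ ⟨q, hq, rfl⟩; exact hb q hq)

theorem lowerStep_of_mem {g : ℝ × ℝ → ℝ} {S : Multiset (ℝ × ℝ)} {ℓ : ℕ} {i : ℕ × ℕ}
    (hi : i ∈ cellIndices ℓ) {p : ℝ × ℝ} (hp : p ∈ cellRect S ℓ i) :
    lowerStep g S ℓ p = cellInf g S ℓ i := by
  rw [lowerStep, Finset.sum_eq_single_of_mem i hi, Set.indicator_of_mem hp]
  intro j hj hne
  exact Set.indicator_of_notMem
    (fun h => Set.disjoint_left.1 (pairwiseDisjoint_cellRect S ℓ hj hi hne) h hp) _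

theorem lowerStep_nonneg {g : ℝ × ℝ → ℝ} (hg : ∀ p, 0 ≤ g p) (S : Multiset (ℝ × ℝ)) (ℓ : ℕ)
    (p : ℝ × ℝ) : 0 ≤ lowerStep g S ℓ p :=
  Finset.sum_nonneg fun i _ => Set.indicator_nonneg (fun _ _ => cellInf_nonneg hg S ℓ i) p

theorem lowerStep_le {g : ℝ × ℝ → ℝ} (hg : ∀ p, 0 ≤ g p) (S : Multiset (ℝ × ℝ)) (ℓ : ℕ)
    (p : ℝ × ℝ) : lowerStep g S ℓ p ≤ g p := by
  by_cases h : ∃ i ∈ cellIndices ℓ, p ∈ cellRect S ℓ i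
  · obtain ⟨i, hi, hp⟩ := h
    rw [lowerStep_of_mem hi hp]
    exact cellInf_le hg hp
  · push Not at h
    rw [lowerStep, Finset.sum_eq_zero fun i hi => Set.indicator_of_notMem (h i hi) _]
    exact hg p

theorem measurableSet_cellRect (S : Multiset (ℝ × ℝ)) (ℓ : ℕ) (i : ℕ × ℕ) :
    MeasurableSet (cellRect S ℓ i) := measurableSet_Ico.prod measurableSet_Ico

theorem measurable_lowerStep (g : ℝ × ℝ → ℝ) (S : Multiset (ℝ × ℝ)) (ℓ : ℕ) :
    Measurable (lowerStep g S ℓ) :=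
  Finset.measurable_fun_sum _ fun i _ => measurable_const.indicator (measurableSet_cellRect S ℓ i)

theorem integral_lowerStep (g : ℝ × ℝ → ℝ) (S : Multiset (ℝ × ℝ)) (ℓ : ℕ) :
    ∫ p, lowerStep g S ℓ p = ∑ i ∈ cellIndices ℓ, cellInf g S ℓ i *
      (segmentWidth (S.map Prod.fst) ℓ * segmentWidth (S.map Prod.snd) ℓ) := by
  have hreal : ∀ i, volume.real (cellRect S ℓ i) =
      segmentWidth (S.map Prod.fst) ℓ * segmentWidth (S.map Prod.snd) ℓ := by
    intro i
    rw [cellRect, Measure.volume_eq_prod, measureReal_prod_prod, Real.volume_real_Ico,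
      Real.volume_real_Ico, ← segmentLeft_add_width, ← segmentLeft_add_width, add_sub_cancel_left,
      add_sub_cancel_left, max_eq_left (segmentWidth_nonneg _ _),
      max_eq_left (segmentWidth_nonneg _ _)]
  have hfin : ∀ i, volume (cellRect S ℓ i) ≠ ⊤ := by
    intro i
    rw [cellRect, Measure.volume_eq_prod, Measure.prod_prod]
    exact ENNReal.mul_ne_top (by simp) (by simp)
  unfold lowerStep
  rw [integral_finsetSum _ fun i _ => (integrable_indicator_iff (measurableSet_cellRect S ℓ i)).2
    (integrableOn_const (hfin i))]
  refine Finset.sum_congr rfl fun i _ => ?_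
  rw [integral_indicator_const _ (measurableSet_cellRect S ℓ i), hreal, smul_eq_mul, mul_comm]

/-- Where the truncation is positive, sample points on both sides eventually place `p` in a
half-open cell. This cell has small sides, so by continuity the infimum over it is close to the
value at `p`. -/
theorem tendsto_lowerStep {f : ℝ × ℝ → ℝ} (hf : Integrable f) (hf0 : ∀ p, 0 ≤ f p)
    {S : ℕ → Multiset (ℝ × ℝ)} (hS : HasSmallDeficit f S) {ℓ : ℕ → ℕ}
    (hpos : ∀ᶠ n in atTop, 0 < segmentWidth ((S n).map Prod.fst) (ℓ n) ∧
      0 < segmentWidth ((S n).map Prod.snd) (ℓ n))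
    (hw : Tendsto (fun n => segmentWidth ((S n).map Prod.fst) (ℓ n)) atTop (𝓝 0))
    (hv : Tendsto (fun n => segmentWidth ((S n).map Prod.snd) (ℓ n)) atTop (𝓝 0)) (m : ℕ)
    {p : ℝ × ℝ} (hp : ContinuousAt f p) :
    Tendsto (fun n => lowerStep (boxTruncation f m) (S n) (ℓ n) p) atTop
      (𝓝 (boxTruncation f m p)) := by
  have hg0 := boxTruncation_nonneg m hf0
  rcases (hg0 p).eq_or_lt with h0 | h0
  · rw [← h0]
    refine tendsto_const_nhds.congr fun n => ?_
    exact le_antisymm (lowerStep_nonneg hg0 _ _ p) ((lowerStep_le hg0 _ _ p).trans h0.ge)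
  · refine tendsto_order.2 ⟨fun b hb => ?_, fun b hb =>
      Eventually.of_forall fun n => (lowerStep_le hg0 _ _ p).trans_lt hb⟩
    have hev := (continuousAt_boxTruncation m hp h0).eventually
      (lt_mem_nhds (show (b + boxTruncation f m p) / 2 < boxTruncation f m p by linarith))
    obtain ⟨r, hr, hball⟩ := Metric.eventually_nhds_iff.1 hev
    filter_upwards [hpos, hw.eventually (gt_mem_nhds hr), hv.eventually (gt_mem_nhds hr),
      eventually_exists_lt_and_gt hf hS hp (h0.trans_le (boxTruncation_le m hf0 p))]
      with n ⟨hwn, hvn⟩ hwr hvr ⟨⟨z, hz, hz1, hz2⟩, u, hu, hu1, hu2⟩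
    obtain ⟨a, ha, hpa⟩ := exists_mem_segment hwn (x := p.1)
      ⟨(orderStat_one_le (Multiset.mem_map_of_mem Prod.fst hz)).trans hz1.le,
        hu1.trans_le (le_orderStat_card (Multiset.mem_map_of_mem Prod.fst hu))⟩
    obtain ⟨d, hd, hpd⟩ := exists_mem_segment hvn (x := p.2)
      ⟨(orderStat_one_le (Multiset.mem_map_of_mem Prod.snd hz)).trans hz2.le,
        hu2.trans_le (le_orderStat_card (Multiset.mem_map_of_mem Prod.snd hu))⟩
    have hmem : p ∈ cellRect (S n) (ℓ n) (a, d) := ⟨hpa, hpd⟩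
    rw [lowerStep_of_mem (i := (a, d)) (mem_cellIndices.2 ⟨ha, hd⟩) hmem]
    refine lt_of_lt_of_le (show b < (b + boxTruncation f m p) / 2 by linarith)
      (le_cellInf hmem fun q hq => (hball ?_).le)
    rw [← segmentLeft_add_width] at hpa hpd
    obtain ⟨hq1, hq2⟩ := hq
    simp only [← segmentLeft_add_width] at hq1 hq2
    rw [Prod.dist_eq, max_lt_iff, Real.dist_eq, Real.dist_eq, abs_lt, abs_lt]
    exact ⟨⟨by linarith [hpa.2, hq1.1], by linarith [hpa.1, hq1.2]⟩,
      ⟨by linarith [hpd.2, hq2.1], by linarith [hpd.1, hq2.2]⟩⟩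

theorem tendsto_integral_lowerStep {f : ℝ × ℝ → ℝ} (hf : Integrable f) (hf0 : ∀ p, 0 ≤ f p)
    (hcont : ∀ᵐ p : ℝ × ℝ, ContinuousAt f p)
    {S : ℕ → Multiset (ℝ × ℝ)} (hS : HasSmallDeficit f S) {ℓ : ℕ → ℕ}
    (hpos : ∀ᶠ n in atTop, 0 < segmentWidth ((S n).map Prod.fst) (ℓ n) ∧
      0 < segmentWidth ((S n).map Prod.snd) (ℓ n))
    (hw : Tendsto (fun n => segmentWidth ((S n).map Prod.fst) (ℓ n)) atTop (𝓝 0))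
    (hv : Tendsto (fun n => segmentWidth ((S n).map Prod.snd) (ℓ n)) atTop (𝓝 0)) (m : ℕ) :
    Tendsto (fun n => ∫ p, lowerStep (boxTruncation f m) (S n) (ℓ n) p) atTop
      (𝓝 (∫ p, boxTruncation f m p)) := by
  have hg0 := boxTruncation_nonneg m hf0
  refine tendsto_integral_of_dominated_convergence f
    (fun n => (measurable_lowerStep _ _ _).aestronglyMeasurable) hf
    (fun n => ae_of_all _ fun p => ?_) ?_
  · rw [Real.norm_of_nonneg (lowerStep_nonneg hg0 _ _ p)]
    exact (lowerStep_le hg0 _ _ p).trans (boxTruncation_le m hf0 p)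
  · filter_upwards [hcont] with p hp using tendsto_lowerStep hf hf0 hS hpos hw hv m hp

/-! ### Choice of the meshes and conclusion. -/

theorem exists_one_div_two_pow_le {x : ℝ} (h0 : 0 < x) (h1 : x ≤ 1) :
    ∃ j : ℕ, 1 / 2 ^ j ≤ x ∧ (2 : ℝ) ^ j ≤ 2 / x := by
  obtain ⟨j, hj1, hj2⟩ := exists_nat_pow_near ((one_le_div h0).2 h1) (one_lt_two (α := ℝ))
  refine ⟨j + 1, ?_, ?_⟩
  · rw [div_le_iff₀ (by positivity), ← div_le_iff₀' h0]
    exact hj2.le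
  · rw [pow_succ, mul_comm, ← mul_one_div 2 x]
    gcongr

/-- With `r = √(n * a * b)`, the mesh has about `4 * r / (δ ^ 2 * a * b) = 4 * n / (δ ^ 2 * r)`
rectangles per unit area, which is at most `θ * n` once `r` is large. -/
theorem two_pow_add_le {a b x θ n r δ : ℝ} {j k : ℕ} (hδ : 0 < δ) (ha : 0 < a)
    (hb : 0 < b) (hr : 0 < r) (hx : x = a * b) (hrr : r * r = n * x) (hθ : 4 / (δ ^ 2 * θ) ≤ r)
    (hθ0 : 0 < θ) (hj : (2 : ℝ) ^ j ≤ 2 / (δ * a / r)) (hk : (2 : ℝ) ^ k ≤ 2 / (δ * b)) :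
    (2 : ℝ) ^ (j + k) ≤ θ * n := by
  subst hx
  have hn : n = r * r / (a * b) := by rw [hrr]; field_simp
  calc (2 : ℝ) ^ (j + k) ≤ 2 / (δ * a / r) * (2 / (δ * b)) := by rw [pow_add]; gcongr
    _ = 4 / (δ ^ 2 * θ) * (θ * r / (a * b)) := by field_simp; ring
    _ ≤ r * (θ * r / (a * b)) := by gcongr
    _ = θ * n := by rw [hn]; ring

theorem eventually_le_integral_min {f : ℝ × ℝ → ℝ} (hf : Integrable f) (hfm : Measurable f)
    (hf0 : ∀ p, 0 ≤ f p) (hf1 : ∫ p, f p = 1) (hcont : ∀ᵐ p : ℝ × ℝ, ContinuousAt f p)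
    {S : ℕ → Multiset (ℝ × ℝ)} (hcard : ∀ n, (S n).card = n)
    (hmono : Monotone S) (hS : HasSmallDeficit f S) {ℓ : ℕ → ℕ} (hℓ_top : Tendsto ℓ atTop atTop)
    (hℓ_sq : (fun n => (ℓ n : ℝ) ^ 2) =o[atTop] fun n => (n : ℝ))
    (hw : Tendsto (fun n => segmentWidth ((S n).map Prod.fst) (ℓ n)) atTop (𝓝 0))
    (hv : Tendsto (fun n => segmentWidth ((S n).map Prod.snd) (ℓ n)) atTop (𝓝 0))
    {ε : ℝ} (hε : 0 < ε) :
    ∀ᶠ n : ℕ in atTop, 1 - 12 * ε - 8 * (ℓ n * Real.sqrt n + ℓ n ^ 2) / n ≤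
      ∫ p, min (f p) (partitionedDensity (S n) (ℓ n) p) := by
  have hbox := tendsto_integral_boxTruncation hf hfm hf0
  rw [hf1] at hbox
  obtain ⟨m, hm1, hm0⟩ := ((hbox.eventually (lt_mem_nhds (show 1 - ε < 1 by linarith))).and
    (eventually_gt_atTop 0)).exists
  have hg0 := boxTruncation_nonneg m hf0
  obtain ⟨θ, hθ, hdef⟩ := hS m hm0 ε hε
  -- Chosen so that the boundary loss `(4 * √C + 16) * δ` with `C = m` equals `ε`. The total error
  -- is then `3 * ε + 5 * ε + ε`, within `12 * ε`.
  set δ := ε / (4 * Real.sqrt m + 16) with hδdef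
  have hδ : 0 < δ := by positivity
  have harea := eventually_le_mul_area hf hf0 hf1 hcont hmono hS hℓ_top hℓ_sq
    (max 1 ((4 / (δ ^ 2 * θ)) ^ 2))
  have hlow := tendsto_integral_lowerStep hf hf0 hcont hS (harea.mono fun n h => ⟨h.1, h.2.1⟩)
    hw hv m
  filter_upwards [hdef, harea, hlow.eventually (lt_mem_nhds hm1),
    hw.eventually (gt_mem_nhds (show 0 < 1 / δ by positivity)),
    hv.eventually (gt_mem_nhds (show 0 < 1 / δ by positivity)), eventually_gt_atTop 0]
    with n hdefn ⟨hwn, hvn, hA⟩ hlown hw1 hv1 hn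
  -- Now `δ * w` and `δ * v` are below `1`, as the choice of dyadic scales requires.
  rw [lt_div_iff₀ hδ] at hw1 hv1
  have hn' : (0 : ℝ) < n := by exact_mod_cast hn
  rw [integral_lowerStep] at hlown
  set w := segmentWidth ((S n).map Prod.fst) (ℓ n) with hwdef
  set v := segmentWidth ((S n).map Prod.snd) (ℓ n) with hvdef
  have hA1 : 1 ≤ n * (w * v) := (le_max_left _ _).trans hA
  have hr1 : 1 ≤ Real.sqrt (n * (w * v)) := Real.one_le_sqrt.2 hA1
  have hrθ : 4 / (δ ^ 2 * θ) ≤ Real.sqrt (n * (w * v)) :=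
    Real.le_sqrt_of_sq_le ((le_max_right _ _).trans hA)
  have hrr : Real.sqrt (n * (w * v)) * Real.sqrt (n * (w * v)) = n * (w * v) :=
    Real.mul_self_sqrt (by positivity)
  obtain ⟨j₁, hj₁, hj₁'⟩ := exists_one_div_two_pow_le
    (show 0 < δ * w / Real.sqrt (n * (w * v)) by positivity)
    ((div_le_self (by positivity) hr1).trans (by linarith))
  obtain ⟨k₁, hk₁, hk₁'⟩ := exists_one_div_two_pow_le (show 0 < δ * v by positivity) (by linarith)
  obtain ⟨j₂, hj₂, hj₂'⟩ := exists_one_div_two_pow_le (show 0 < δ * w by positivity) (by linarith)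
  obtain ⟨k₂, hk₂, hk₂'⟩ := exists_one_div_two_pow_le
    (show 0 < δ * v / Real.sqrt (n * (w * v)) by positivity)
    ((div_le_self (by positivity) hr1).trans (by linarith))
  have h₁ : (2 : ℝ) ^ (j₁ + k₁) ≤ θ * n :=
    two_pow_add_le hδ hwn hvn (by positivity) rfl hrr hrθ hθ hj₁' hk₁'
  have h₂ : (2 : ℝ) ^ (j₂ + k₂) ≤ θ * n := by
    rw [add_comm]
    exact two_pow_add_le hδ hvn hwn (by positivity) (mul_comm w v) hrr hrθ hθ hk₂' hj₂'
  have hM : ∑ i ∈ cellIndices (ℓ n), cellInf (boxTruncation f m) (S n) (ℓ n) i * (w * v) ≤ 1 := by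
    rw [hwdef, hvdef, ← integral_lowerStep, ← hf1]
    refine integral_mono_of_nonneg (ae_of_all _ (lowerStep_nonneg hg0 _ _)) hf
      (ae_of_all _ fun p => (lowerStep_le hg0 _ _ p).trans (boxTruncation_le m hf0 p))
  have hcorner : ∀ i, (segmentLeft ((S n).map Prod.fst) (ℓ n) i.1,
      segmentLeft ((S n).map Prod.snd) (ℓ n) i.2) ∈ cellRect (S n) (ℓ n) i := fun i =>
    ⟨⟨le_rfl, by rw [← segmentLeft_add_width]; linarith⟩,
      ⟨le_rfl, by rw [← segmentLeft_add_width]; linarith⟩⟩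
  have hmain := le_integral_min (S := S n) (by rw [hcard]; exact hn) hwdef.symm hvdef.symm hwn hvn hf
    hf0 (R := m) (c := cellInf (boxTruncation f m) (S n) (ℓ n)) (C := m) (ε := ε)
    (δ := δ) (fun i _ => cellInf_nonneg hg0 _ _ i) (by positivity)
    (fun i _ => (cellInf_le hg0 (hcorner i)).trans (boxTruncation_le_natCast m _))
    (fun i _ p hp => (cellInf_le hg0 hp).trans (boxTruncation_le m hf0 p))
    (fun i _ hi p hp => Set.prod_mono Set.Ioo_subset_Ico_self Set.Ioo_subset_Ico_self
      (mem_of_boxTruncation_pos m (hi.trans_le (cellInf_le hg0 hp))))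
    hM (by rw [hcard]; exact hA1) hδ.le
    (by rw [hcard]; exact hdefn j₁ k₁ h₁) (by rw [hcard]; exact hdefn j₂ k₂ h₂)
    (by rw [hcard]; exact hj₁) hk₁ hj₂ (by rw [hcard]; exact hk₂)
  rw [hcard] at hmain
  have hδε : (4 * Real.sqrt m + 16) * δ = ε := by rw [hδdef]; field_simp
  rw [hδε] at hmain
  linarith

theorem tendsto_mul_sqrt_add_sq_div {ℓ : ℕ → ℕ}
    (hℓ_sq : (fun n => (ℓ n : ℝ) ^ 2) =o[atTop] fun n => (n : ℝ)) (a b : ℝ) :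
    Tendsto (fun n : ℕ => (a * (ℓ n * Real.sqrt n + ℓ n ^ 2) + b * ℓ n ^ 2) / n) atTop (𝓝 0) := by
  have h1 := hℓ_sq.tendsto_div_nhds_zero
  have h2 := h1.sqrt
  rw [Real.sqrt_zero] at h2
  have h3 := ((h2.add h1).const_mul a).add (h1.const_mul b)
  simp only [add_zero, mul_zero] at h3
  refine h3.congr' ?_
  filter_upwards [eventually_gt_atTop 0] with n hn
  have hn' : (0 : ℝ) < n := by exact_mod_cast hn
  have e : Real.sqrt ((ℓ n : ℝ) ^ 2 / n) = ℓ n * Real.sqrt n / n := by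
    rw [Real.sqrt_div (by positivity), Real.sqrt_sq (by positivity),
      div_eq_div_iff (by positivity) (by positivity), mul_assoc, Real.mul_self_sqrt hn'.le]
  rw [e]
  ring

theorem tendsto_integral_abs_partitionedDensity_sub {f : ℝ × ℝ → ℝ} (hf : Integrable f)
    (hfm : Measurable f)
    (hf0 : ∀ p, 0 ≤ f p) (hf1 : ∫ p, f p = 1) (hcont : ∀ᵐ p : ℝ × ℝ, ContinuousAt f p)
    {S : ℕ → Multiset (ℝ × ℝ)} (hcard : ∀ n, (S n).card = n)
    (hmono : Monotone S) (hS : HasSmallDeficit f S) {ℓ : ℕ → ℕ} (hℓ_top : Tendsto ℓ atTop atTop)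
    (hℓ_sq : (fun n => (ℓ n : ℝ) ^ 2) =o[atTop] fun n => (n : ℝ))
    (hw : Tendsto (fun n => segmentWidth ((S n).map Prod.fst) (ℓ n)) atTop (𝓝 0))
    (hv : Tendsto (fun n => segmentWidth ((S n).map Prod.snd) (ℓ n)) atTop (𝓝 0)) :
    Tendsto (fun n => ∫ p, |partitionedDensity (S n) (ℓ n) p - f p|) atTop (𝓝 0) := by
  refine tendsto_order.2 ⟨fun b hb => Eventually.of_forall fun n =>
    hb.trans_le (integral_nonneg fun p => abs_nonneg _), fun b hb => ?_⟩
  -- The overlap error enters twice: `2 * 12 * (b / 48) = b / 2`. The remaining terms, each below `b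
  -- / 8`, enter three times, so the total stays below `b`.
  have hε : 0 < b / 48 := by positivity
  filter_upwards [eventually_le_integral_min hf hfm hf0 hf1 hcont hcard hmono hS hℓ_top hℓ_sq hw hv hε,
    (tendsto_mul_sqrt_add_sq_div hℓ_sq 8 48).eventually (gt_mem_nhds (show 0 < b / 8 by positivity)),
    (tendsto_mul_sqrt_add_sq_div hℓ_sq 8 0).eventually (gt_mem_nhds (show 0 < b / 8 by positivity)),
    eventually_gt_atTop 0] with n hmin h1 h2 hn
  have hupper := integral_partitionedDensity_le (S := S n) (by rw [hcard]; exact hn) (ℓ n)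
  rw [hcard] at hupper
  have hfhat := integrable_partitionedDensity (S n) (ℓ n)
  have hmi : Integrable fun p => min (f p) (partitionedDensity (S n) (ℓ n) p) := hf.inf hfhat
  have heq : ∫ p, |partitionedDensity (S n) (ℓ n) p - f p| =
      (∫ p, partitionedDensity (S n) (ℓ n) p) + (∫ p, f p) -
        2 * ∫ p, min (f p) (partitionedDensity (S n) (ℓ n) p) := by
    have hadd : Integrable fun p => partitionedDensity (S n) (ℓ n) p + f p := hfhat.add hf
    rw [← integral_add hfhat hf, ← integral_const_mul, ← integral_sub hadd (hmi.const_mul 2)]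
    refine integral_congr_ae (ae_of_all _ fun p => ?_)
    simp only
    rcases le_total (f p) (partitionedDensity (S n) (ℓ n) p) with h | h
    · rw [abs_of_nonneg (by linarith), min_eq_left h]; ring
    · rw [abs_of_nonpos (by linarith), min_eq_right h]; ring
  rw [heq, hf1]
  rw [zero_mul, add_zero] at h2
  linarith

theorem corollary6 {Ω : Type*} [MeasurableSpace Ω] (P : Measure Ω) [IsProbabilityMeasure P]
    (f : ℝ × ℝ → ℝ) (hf_meas : Measurable f) (hf_nonneg : ∀ p, 0 ≤ f p)
    (hf_cont : ∀ᵐ p : ℝ × ℝ, ContinuousAt f p)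
    (Z : ℕ → Ω → ℝ × ℝ) (hZ_meas : ∀ i, Measurable (Z i)) (hZ_indep : iIndepFun Z P)
    (hZ_law : ∀ i, P.map (Z i) = volume.withDensity fun p => ENNReal.ofReal (f p))
    (ℓ : ℕ → ℕ) (hℓ_top : Tendsto ℓ atTop atTop)
    (hℓ_sq : (fun n => (ℓ n : ℝ) ^ 2) =o[atTop] fun n => (n : ℝ))
    (hwidth_fst : ∀ᵐ ω ∂P,
      Tendsto (fun n => segmentWidth ((firstSample Z n ω).map Prod.fst) (ℓ n)) atTop (𝓝 0))
    (hwidth_snd : ∀ᵐ ω ∂P,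
      Tendsto (fun n => segmentWidth ((firstSample Z n ω).map Prod.snd) (ℓ n)) atTop (𝓝 0)) :
    ∀ᵐ ω ∂P,
      (∀ n, Integrable fun p => partitionedDensity (firstSample Z n ω) (ℓ n) p) ∧
      Tendsto (fun n => ∫ p, |partitionedDensity (firstSample Z n ω) (ℓ n) p - f p|)
        atTop (𝓝 0) := by
  -- That `f` is integrable with total mass `1` is read off from its being the density of the law of
  -- `Z 0`.
  have hprob : IsProbabilityMeasure (volume.withDensity fun p => ENNReal.ofReal (f p)) := by
    rw [← hZ_law 0]
    exact Measure.isProbabilityMeasure_map (hZ_meas 0).aemeasurable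
  have hlint : ∫⁻ p, ENNReal.ofReal (f p) = 1 := by
    have := hprob.measure_univ
    rwa [withDensity_apply _ MeasurableSet.univ, Measure.restrict_univ] at this
  have hf : Integrable f := by
    refine ⟨hf_meas.aestronglyMeasurable, ?_⟩
    rw [hasFiniteIntegral_iff_ofReal (ae_of_all _ hf_nonneg), hlint]
    exact ENNReal.one_lt_top
  have hf1 : ∫ p, f p = 1 := by
    rw [integral_eq_lintegral_of_nonneg_ae (ae_of_all _ hf_nonneg) hf_meas.aestronglyMeasurable,
      hlint, ENNReal.toReal_one]
  filter_upwards [ae_hasSmallDeficit hf_meas hf_nonneg hZ_meas hZ_indep hZ_law, hwidth_fst,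
    hwidth_snd] with ω hS hw hv
  refine ⟨fun n => integrable_partitionedDensity _ _, ?_⟩
  refine tendsto_integral_abs_partitionedDensity_sub hf hf_meas hf_nonneg hf1 hf_cont
    (S := fun n => firstSample Z n ω) (fun n => by simp [firstSample]) (fun a b hab => ?_) hS
    hℓ_top hℓ_sq hw hv
  exact Multiset.map_le_map (Multiset.range_le.2 hab)
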